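/- Let $m\ge 1$ and let $\alpha_0,\alpha_1,\dots,\alpha_m$ be positive rational numbers with $\alpha_i-\alpha_j\notin\mathbb Z$ for $1\le i<j\le m$. Put $(\alpha)_0=1$, $(\alpha)_n=\alpha(\alpha+1)\cdots(\alpha+n-1)$ and $$\varphi_j(z)=\sum_{n=0}^\infty\frac{(\alpha_j)_n}{(\alpha_j+\alpha_0)_n}z^n\qquad(j=1,\dots,m).$$ In lowest terms with positive integers, write $\alpha_j=r_j/s_j$ $(0\le j\le m)$ and $\alpha_j+\alpha_0=u_j/v_j$ $(1\le j\le m)$, and put $d_j=s_0s_j/v_j$, which is an integer $(1\le j\le m)$. With $j$ running over $1,\dots,m$, let $R,S,U,V$ be the maxima of the $r_j,s_j,u_j,v_j$, let $s,v,d$ be the least common multiples of the $s_j,v_j,d_j$, and let $\tilde d=d/\gcd(d,s_0)$. For an integer $n\ge1$ let $\epsilon(n)=\prod_{q\mid n}q^{1/(q-1)}$ (product over primes $q$). Let $\theta>1$ and let $c(\theta)>1$ be any real number such that $\pi(x)\le\theta x/\log x$ for all real $x\ge c(\theta)$, where $\pi(x)$ is the number of primes $\le x$. Put $$c_1=\theta(m(R+S)+U),\quad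 c_2=m\theta S,\quad c_3=\log(s_0^2\epsilon(s_0)\epsilon(v)),\quad c_4=\theta V+\log(\tilde d\,\epsilon(s)),$$ $$c_5=\theta(2(r_0-s_0)+mU),\quad c_6=2\theta s_0+\log(d\,\epsilon(s)/s_0),\quad c_7=m\theta V,\quad c_8=c_3+c_4+c_6+c_7+3.$$ Let $p$ be a prime and let $|\cdot|_p$ be the $p$-adic absolute value with $|p|_p=p^{-1}$. Put $\delta(2,p)=1$ if $p=2$ and $s$ is even, and $\delta(2,p)=0$ otherwise; put $\delta(p)=1$ if $p\mid s$, and $\delta(p)=0$ otherwise. Let $\tau>0$ and $\delta\ge0$ be real numbers with $\tau>4\delta(1+(m+1)\tau)$, and let $\beta=a/b$ with integers $a$ and $b\ne0$ satisfying $$\gcd(a,b)=1,\qquad |a|_p\le\min\{2^{-\delta(2,p)}|s|_p,\ |a|^{-1+\delta}\},\qquad |a|>|b|^{2(1+1/\tau)}e^{2(c_2(1+1/\tau)+(c_8+2)(m+1+1/\tau))}.$$ Then the series $\varphi_1(\beta),\dots,\varphi_m(\beta)$ converge in $\mathbb Q_p$, and $$|\ell_0+\ell_1\varphi_1(\beta)+\cdots+\ell_m\varphi_m(\beta)|_p>\tilde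 H^{-1-(m+1)\tau}$$ for all $(\ell_0,\dots,\ell_m)\in\mathbb Z^{m+1}\setminus\{0\}$ with $\tilde H\ge\tilde H_0$. Here $\tilde H=h_0h_1\cdots h_m$ with $h_0=\max\{|\ell_0|,\dots,|\ell_m|\}$ and $h_j=\max\{1,|\ell_j|\}$ $(1\le j\le m)$, and $$\log\tilde H_0=\max\left\{\frac{(\tilde N_1+m+1)\log|a|}{1+(m+1)\tau},\ \frac{8\log|a|}{\tau}\right\},\qquad \tilde N_1=\max\{(m+1)c(\theta),\ c_1+c_5,\ \log(2\tilde d)+4\delta(p)\log|a|\}.$$ -/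

import Mathlib

namespace PadicLinForm

noncomputable section

/-- The `n`-th term `(x)_n / (x + α₀)_n * z ^ n` of the `p`-adic series `φ` with parameters
`x`, `α₀`, where `(x)_n = x (x + 1) ⋯ (x + n - 1)` is the Pochhammer symbol. -/
def phiTerm (p : ℕ) [Fact p.Prime] (α₀ x : ℚ) (z : ℚ_[p]) (n : ℕ) : ℚ_[p] :=
  (((ascPochhammer ℚ n).eval x / (ascPochhammer ℚ n).eval (x + α₀) : ℚ) : ℚ_[p]) * z ^ n

/-- The sum `φ(z) = ∑ (x)_n / (x + α₀)_n * z ^ n` in `ℚ_[p]`. -/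
def phi (p : ℕ) [Fact p.Prime] (α₀ x : ℚ) (z : ℚ_[p]) : ℚ_[p] :=
  ∑' n : ℕ, phiTerm p α₀ x z n

/-! ### Arithmetic invariants of the parameters `α₀` and `α 0, …, α (m - 1)`

The reduced fractions are `α₀ = r₀ / s₀`, `α j = r_j / s_j` and `α j + α₀ = u_j / v_j`. -/

/-- `R = max r_j`. -/
def maxR {m : ℕ} (α : Fin m → ℚ) : ℕ := Finset.univ.sup fun j => (α j).num.natAbs

/-- `S = max s_j`. -/
def maxS {m : ℕ} (α : Fin m → ℚ) : ℕ := Finset.univ.sup fun j => (α j).den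

/-- `U = max u_j`. -/
def maxU {m : ℕ} (α₀ : ℚ) (α : Fin m → ℚ) : ℕ :=
  Finset.univ.sup fun j => (α j + α₀).num.natAbs

/-- `V = max v_j`. -/
def maxV {m : ℕ} (α₀ : ℚ) (α : Fin m → ℚ) : ℕ := Finset.univ.sup fun j => (α j + α₀).den

/-- `s = lcm s_j`. -/
def lcmS {m : ℕ} (α : Fin m → ℚ) : ℕ := Finset.univ.lcm fun j => (α j).den

/-- `v = lcm v_j`. -/
def lcmV {m : ℕ} (α₀ : ℚ) (α : Fin m → ℚ) : ℕ := Finset.univ.lcm fun j => (α j + α₀).den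

/-- The integer `d_j = s₀ s_j / v_j` belonging to `α₀` and `x = α j`. -/
def dPart (α₀ x : ℚ) : ℕ := α₀.den * x.den / (x + α₀).den

/-- The division in `dPart` is exact: `s₀ s_j = d_j v_j`. -/
theorem dPart_mul (α₀ x : ℚ) : α₀.den * x.den = dPart α₀ x * (x + α₀).den := by
  have h : (x + α₀).den ∣ α₀.den * x.den := by
    rw [mul_comm]; exact Rat.add_den_dvd x α₀
  exact (Nat.div_mul_cancel h).symm

/-- `d = lcm d_j`. -/
def lcmD {m : ℕ} (α₀ : ℚ) (α : Fin m → ℚ) : ℕ := Finset.univ.lcm fun j => dPart α₀ (α j)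

/-- `d̃ = d / gcd (d, s₀)`. -/
def dTilde {m : ℕ} (α₀ : ℚ) (α : Fin m → ℚ) : ℕ :=
  lcmD α₀ α / Nat.gcd (lcmD α₀ α) α₀.den

/-- `ε(n) = ∏_{q ∣ n} q ^ (1 / (q - 1))`, the product over the primes `q` dividing `n`. -/
def eps (n : ℕ) : ℝ := ∏ q ∈ n.primeFactors, (q : ℝ) ^ (1 / ((q : ℝ) - 1))

/-- `δ(2, p)`: equal to `1` if `p = 2` and `s` is even, and `0` otherwise. -/
def deltaTwo (p s : ℕ) : ℕ := if p = 2 ∧ Even s then 1 else 0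

/-- `δ(p)`: equal to `1` if `p ∣ s`, and `0` otherwise. -/
def deltaDvd (p s : ℕ) : ℕ := if p ∣ s then 1 else 0

/-! ### The explicit constants -/

/-- `θ` and `c` are admissible if `θ > 1` and `π(x) ≤ θ x / log x` for all real `x ≥ c`
(where `c > 1`, so that the right-hand side makes sense). -/
def AdmissiblePrimeBound (θ c : ℝ) : Prop :=
  1 < θ ∧ 1 < c ∧ ∀ x : ℝ, c ≤ x → (Nat.primeCounting ⌊x⌋₊ : ℝ) ≤ θ * (x / Real.log x)

def c1 {m : ℕ} (θ : ℝ) (α₀ : ℚ) (α : Fin m → ℚ) : ℝ :=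
  θ * (m * ((maxR α : ℝ) + maxS α) + maxU α₀ α)

def c2 {m : ℕ} (θ : ℝ) (α : Fin m → ℚ) : ℝ := m * θ * maxS α

def c3 {m : ℕ} (α₀ : ℚ) (α : Fin m → ℚ) : ℝ :=
  Real.log ((α₀.den : ℝ) ^ 2 * eps α₀.den * eps (lcmV α₀ α))

def c4 {m : ℕ} (θ : ℝ) (α₀ : ℚ) (α : Fin m → ℚ) : ℝ :=
  θ * maxV α₀ α + Real.log ((dTilde α₀ α : ℝ) * eps (lcmS α))

def c5 {m : ℕ} (θ : ℝ) (α₀ : ℚ) (α : Fin m → ℚ) : ℝ :=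
  θ * (2 * ((α₀.num : ℝ) - α₀.den) + m * maxU α₀ α)

def c6 {m : ℕ} (θ : ℝ) (α₀ : ℚ) (α : Fin m → ℚ) : ℝ :=
  2 * θ * α₀.den + Real.log ((lcmD α₀ α : ℝ) * eps (lcmS α) / α₀.den)

def c7 {m : ℕ} (θ : ℝ) (α₀ : ℚ) (α : Fin m → ℚ) : ℝ := m * θ * maxV α₀ α

def c8 {m : ℕ} (θ : ℝ) (α₀ : ℚ) (α : Fin m → ℚ) : ℝ :=
  c3 α₀ α + c4 θ α₀ α + c6 θ α₀ α + c7 θ α₀ α + 3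

/-- `Ñ₁ = max {(m + 1) c(θ), c₁ + c₅, log (2 d̃) + 4 δ(p) log |a|}`. -/
def N1 {m : ℕ} (p : ℕ) (θ c : ℝ) (α₀ : ℚ) (α : Fin m → ℚ) (a : ℤ) : ℝ :=
  max (((m : ℝ) + 1) * c) (max (c1 θ α₀ α + c5 θ α₀ α)
    (Real.log (2 * dTilde α₀ α) + 4 * deltaDvd p (lcmS α) * Real.log |(a : ℝ)|))

/-- The explicit threshold `H̃₀`. -/
def H0 {m : ℕ} (p : ℕ) (θ c : ℝ) (α₀ : ℚ) (α : Fin m → ℚ) (a : ℤ) (τ : ℝ) : ℝ :=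
  Real.exp (max ((N1 p θ c α₀ α a + m + 1) * Real.log |(a : ℝ)| / (1 + ((m : ℝ) + 1) * τ))
    (8 * Real.log |(a : ℝ)| / τ))

/-- `H̃ = h₀ h₁ ⋯ h_m` with `h₀ = max_{0 ≤ j ≤ m} |ℓ_j|` and `h_j = max {1, |ℓ_j|}` for
`1 ≤ j ≤ m`. -/
def HTilde {m : ℕ} (ℓ : Fin (m + 1) → ℤ) : ℕ :=
  (Finset.univ.sup fun i => (ℓ i).natAbs) * ∏ j : Fin m, max 1 (ℓ j.succ).natAbs

end

end PadicLinForm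

namespace PadicLinForm

open Finset

/-! The proof rests on explicit simultaneous Padé approximations with a common denominator. For an
index `ν` with sum `M`, put `N = ν₁ + ⋯ + ν_m`. There is a polynomial `Q` of degree at most `N`, and
there are polynomials `P_j`, with `Q φ_j - P_j = O(z ^ M)`. Written in powers of `X - 1`, `Q` has
Newton coefficients of a product of rising factorials. This makes the coefficient of `z ^ (t + N)`
in `Q φ_j` an explicit nonzero factor times that product at `-(α_j + t)`
(`coeff_padeQ_mul_phiSeries`), and the product vanishes on a block of `ν_j` consecutive `t`.

Let `Λ` be the linear form in the values at `β = a / b`, and let `D` clear the denominators of `Q`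
and the `P_j`. The integer `g = D b ^ M (ℓ₀ Q(β) + ∑ ℓ_j P_j(β))` equals `D b ^ M Q(β) Λ` minus a
remainder whose `p`-adic size is at most `|a|_p ^ M` times a polynomial in `M`. If `g ≠ 0` and `|g|
≤ Z`, then `|g|_p ≥ 1 / Z`. A remainder below `1 / Z` then forces `|Λ|_p ≥ 1 / Z`
(`inv_le_norm_linearForm`). All denominators and coefficient sizes together cost at most `exp ((c₈ +
2) M)` (`pade_total_le`).

That some `g` is nonzero comes from lowering `ν` by one at each of the `m + 1` places. The
determinant of the resulting approximations is a nonzero monomial (`det_padeVec_ne_zero`).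

The product of heights appears because `ℓ_j P_j(β)` has size about `h_j |a| ^ (M - ν_j)` after
clearing `b`. Taking `ν_j` affine in `log h_j` balances all terms, and the total `M` is then about
`(1 + (m + 1) τ) log H̃ / log |a|` (`exists_index`), which gives the exponent. -/

/-! ### Rising factorials. -/

/-- The rising factorial `x (x + 1) ⋯ (x + n - 1)`. -/
def poch (x : ℚ) (n : ℕ) : ℚ := ∏ i ∈ range n, (x + i)

theorem ascPochhammer_eval_eq_poch (x : ℚ) (n : ℕ) : (ascPochhammer ℚ n).eval x = poch x n := by
  induction n with
  | zero => simp [poch]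
  | succ n ih => rw [ascPochhammer_succ_eval, ih, poch, poch, prod_range_succ]

theorem poch_zero (x : ℚ) : poch x 0 = 1 := by simp [poch]

theorem poch_succ (x : ℚ) (n : ℕ) : poch x (n + 1) = poch x n * (x + n) := by
  rw [poch, poch, prod_range_succ]

theorem poch_add (x : ℚ) (m n : ℕ) : poch x (m + n) = poch x m * poch (x + m) n := by
  rw [poch, poch, poch, prod_range_add]
  congr 1
  refine prod_congr rfl fun i _ => ?_
  push_cast; ring

theorem poch_pos {x : ℚ} (hx : 0 < x) (n : ℕ) : 0 < poch x n :=
  prod_pos fun i _ => by positivity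

theorem poch_mono {x y : ℚ} (hx : 0 ≤ x) (h : x ≤ y) (n : ℕ) : poch x n ≤ poch y n :=
  prod_le_prod (fun i _ => by positivity) fun i _ => by linarith

theorem poch_natCast_succ (k n : ℕ) :
    poch ((k : ℚ) + 1) n = (n.factorial : ℚ) * ((k + n).choose n : ℕ) := by
  induction n with
  | zero => simp [poch]
  | succ n ih =>
    rw [poch_succ, ih]
    have h := Nat.add_one_mul_choose_eq (k + n) n
    have h' : ((k + n + 1 : ℕ) : ℚ) * ((k + n).choose n : ℕ) =
      ((k + n + 1).choose (n + 1) : ℕ) * ((n + 1 : ℕ) : ℚ) := by exact_mod_cast h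
    rw [Nat.factorial_succ, ← add_assoc k n 1]
    push_cast at h' ⊢
    linear_combination (n.factorial : ℚ) * h'

/-! ### Size of rising factorials at a prime `q`. -/

section Local

variable {q : ℕ} [Fact q.Prime]

theorem norm_natCast_le_one (n : ℕ) : ‖(n : ℚ_[q])‖ ≤ 1 := by
  exact_mod_cast Padic.norm_int_le_one (p := q) n

theorem norm_eq_inv_norm_den {x : ℚ} (h : q ∣ x.den) : ‖(x : ℚ_[q])‖ = ‖(x.den : ℚ_[q])‖⁻¹ := by
  have hnum : ‖(x.num : ℚ_[q])‖ = 1 := by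
    rw [Padic.norm_intCast_eq_one_iff]
    have h1 : IsCoprime x.num (x.den : ℤ) := by
      rw [Int.isCoprime_iff_gcd_eq_one]; exact x.reduced
    exact h1.of_isCoprime_of_dvd_right (Int.natCast_dvd_natCast.mpr h)
  rw [← one_div, ← hnum, ← norm_div]
  congr 1
  exact_mod_cast congrArg (fun y : ℚ => (y : ℚ_[q])) (Rat.num_div_den x).symm

theorem one_lt_norm_of_dvd_den {x : ℚ} (h : q ∣ x.den) : 1 < ‖(x : ℚ_[q])‖ := by
  rw [norm_eq_inv_norm_den h]
  refine (one_lt_inv₀ ?_).mpr ?_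
  · rw [norm_pos_iff]; exact_mod_cast x.den_ne_zero
  · exact Padic.norm_natCast_lt_one_iff.mpr h

/-- Here `|x|_q > 1 ≥ |i|_q`, so every factor `x + i` has the norm of `x`. -/
theorem norm_poch_of_dvd_den {x : ℚ} (h : q ∣ x.den) (n : ℕ) :
    ‖((poch x n : ℚ) : ℚ_[q])‖ = (‖(x.den : ℚ_[q])‖⁻¹) ^ n := by
  rw [poch, Rat.cast_prod, norm_prod]
  rw [prod_congr rfl (g := fun _ => ‖(x.den : ℚ_[q])‖⁻¹), prod_const, card_range]
  intro i _
  have h1 := one_lt_norm_of_dvd_den h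
  have h2 : ‖(i : ℚ_[q])‖ ≤ 1 := norm_natCast_le_one i
  rw [Rat.cast_add, Rat.cast_natCast, Padic.add_eq_max_of_ne (by linarith),
    max_eq_left (by linarith), norm_eq_inv_norm_den h]

/-- For `x` in `ℤ_q` the quotient `(x)_n / n!` is a multichoose coefficient, hence lies in `ℤ_q`. -/
theorem norm_poch_le_norm_factorial {x : ℚ} (h : ¬ q ∣ x.den) (n : ℕ) :
    ‖((poch x n : ℚ) : ℚ_[q])‖ ≤ ‖(n.factorial : ℚ_[q])‖ := by
  let y : ℤ_[q] := ⟨(x : ℚ_[q]), Padic.norm_rat_le_one h⟩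
  have h1 := Ring.factorial_nsmul_multichoose_eq_ascPochhammer y n
  rw [Polynomial.ascPochhammer_smeval_eq_eval, nsmul_eq_mul] at h1
  have h2 : ((poch x n : ℚ) : ℚ_[q]) = (((ascPochhammer ℤ_[q] n).eval y : ℤ_[q]) : ℚ_[q]) := by
    clear h1
    induction n with
    | zero => simp [poch]
    | succ n ih =>
      rw [poch_succ, ascPochhammer_succ_eval]
      push_cast
      rw [ih]
  rw [h2, ← h1]
  push_cast
  rw [norm_mul]
  exact mul_le_of_le_one_right (norm_nonneg _) (PadicInt.norm_le_one _)

theorem zpow_neg_log_le_norm {n B : ℕ} (hn : n ≠ 0) (hB : n ≤ B) :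
    ((q : ℝ) ^ Nat.log q B)⁻¹ ≤ ‖(n : ℚ_[q])‖ := by
  have hq : 1 < q := (Fact.out : q.Prime).one_lt
  have h1 : ‖(n : ℚ_[q])‖ = ((q : ℝ) ^ padicValNat q n)⁻¹ := by
    rw [Padic.norm_eq_zpow_neg_valuation (by exact_mod_cast hn), Padic.valuation_natCast]
    simp
  rw [h1]
  gcongr
  · exact_mod_cast hq.le
  · exact (padicValNat_le_nat_log n).trans (Nat.log_mono_right hB)

/-- Multiplying by the `q`-adic unit `x.den` turns `x + i` into a positive integer at most `B`. -/
theorem norm_add_natCast_ge {x : ℚ} (hx : 0 < x) (h : ¬ q ∣ x.den) {i B : ℕ}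
    (hB : x.num.natAbs + x.den * i ≤ B) :
    ((q : ℝ) ^ Nat.log q B)⁻¹ ≤ ‖((x : ℚ_[q]) + i)‖ := by
  have hd : ‖(x.den : ℚ_[q])‖ = 1 := by
    refine le_antisymm (norm_natCast_le_one _) ?_
    by_contra hc
    exact h (Padic.norm_natCast_lt_one_iff.mp (not_le.mp hc))
  have hn : 0 < x.num := Rat.num_pos.mpr hx
  have h1 : ((x.num.natAbs + x.den * i : ℕ) : ℚ) = x.den * (x + i) := by
    have : ((x.num.natAbs : ℕ) : ℚ) = x.num := by
      have h0 : (x.num.natAbs : ℤ) = x.num := by omega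
      exact congrArg (fun z : ℤ => (z : ℚ)) h0
    push_cast
    rw [this, mul_add, Rat.den_mul_eq_num]
  have h2 : ((x.num.natAbs + x.den * i : ℕ) : ℚ_[q]) = x.den * (x + i) := by
    exact_mod_cast congrArg (fun y : ℚ => (y : ℚ_[q])) h1
  have h3 := zpow_neg_log_le_norm (q := q) (n := x.num.natAbs + x.den * i) (by omega) hB
  rwa [h2, norm_mul, hd, one_mul] at h3

theorem norm_factorial_antitone {m n : ℕ} (h : m ≤ n) :
    ‖(n.factorial : ℚ_[q])‖ ≤ ‖(m.factorial : ℚ_[q])‖ := by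
  obtain ⟨k, hk⟩ := Nat.factorial_dvd_factorial h
  rw [hk]; push_cast; rw [norm_mul]
  exact mul_le_of_le_one_right (norm_nonneg _) (norm_natCast_le_one k)

/-- If `y + i` is the `q`-adically smallest factor, the ultrametric inequality gives `|l - i| ≤ |y +
l|` for every `l`. The factors other than `y + i` therefore dominate `i! k!`, which divides `(i + 1
+ k)!`. -/
theorem norm_prod_add_ge_factorial (y : ℚ_[q]) (i k : ℕ)
    (hmin : ∀ l < i + 1 + k, ‖y + i‖ ≤ ‖y + l‖) :
    ‖((i + 1 + k).factorial : ℚ_[q])‖ * ‖y + i‖ ≤ ∏ l ∈ range (i + 1 + k), ‖y + l‖ := by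
  have key : ∀ l < i + 1 + k, ‖((l : ℚ_[q]) - i)‖ ≤ ‖y + l‖ := fun l hl => by
    have h := Padic.nonarchimedean (p := q) (y + l) (-(y + i))
    rw [norm_neg, max_eq_left (hmin l hl)] at h
    rwa [show (l : ℚ_[q]) - i = y + l + -(y + i) by ring]
  have h1 : ‖(i.factorial : ℚ_[q])‖ ≤ ∏ l ∈ range i, ‖y + l‖ := by
    rw [← prod_range_reflect, ← prod_range_add_one_eq_factorial, Nat.cast_prod, norm_prod]
    refine prod_le_prod (fun _ _ => norm_nonneg _) fun l hl => ?_
    have hl := mem_range.mp hl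
    refine le_trans (le_of_eq ?_) (key (i - 1 - l) (by omega))
    rw [← norm_neg]
    congr 1
    rw [Nat.sub_sub, Nat.cast_sub (by omega)]
    push_cast; ring
  have h2 : ‖(k.factorial : ℚ_[q])‖ ≤ ∏ l ∈ range k, ‖y + ((i + 1 + l : ℕ) : ℚ_[q])‖ := by
    rw [← prod_range_add_one_eq_factorial, Nat.cast_prod, norm_prod]
    refine prod_le_prod (fun _ _ => norm_nonneg _) fun l hl => ?_
    have hl := mem_range.mp hl
    refine le_trans (le_of_eq ?_) (key (i + 1 + l) (by omega))
    congr 1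
    push_cast; ring
  have h3 : ‖((i + 1 + k).factorial : ℚ_[q])‖ ≤
      ‖(i.factorial : ℚ_[q])‖ * ‖(k.factorial : ℚ_[q])‖ := by
    rw [← norm_mul]
    obtain ⟨c, hc⟩ := (Nat.factorial_mul_factorial_dvd_factorial_add i k).trans
      (Nat.factorial_dvd_factorial (by omega : i + k ≤ i + 1 + k))
    rw [hc]; push_cast; rw [norm_mul]
    exact mul_le_of_le_one_right (norm_nonneg _) (norm_natCast_le_one c)
  rw [prod_range_add, prod_range_succ]
  calc _ ≤ (‖(i.factorial : ℚ_[q])‖ * ‖(k.factorial : ℚ_[q])‖) * ‖y + i‖ := by gcongr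
    _ ≤ ((∏ l ∈ range i, ‖y + l‖) * ∏ l ∈ range k, ‖y + ((i + 1 + l : ℕ) : ℚ_[q])‖) * ‖y + i‖ := by
      gcongr
    _ = _ := by ring

/-- Converse of `norm_poch_le_norm_factorial`: only the smallest factor can lose against `n!`, and
it loses at most the largest power of `q` up to `B`. -/
theorem norm_factorial_le_norm_poch {x : ℚ} (hx : 0 < x) (h : ¬ q ∣ x.den) {n B : ℕ}
    (hB : x.num.natAbs + x.den * n ≤ B) :
    ‖(n.factorial : ℚ_[q])‖ ≤ ‖((poch x n : ℚ) : ℚ_[q])‖ * (q : ℝ) ^ Nat.log q B := by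
  have hq : (1 : ℝ) ≤ q := by exact_mod_cast (Fact.out : q.Prime).one_lt.le
  rcases n.eq_zero_or_pos with rfl | hn
  · simpa [poch] using one_le_pow₀ hq
  obtain ⟨i, hi, hmin⟩ := exists_min_image (range n) (fun l : ℕ => ‖(x : ℚ_[q]) + l‖)
    ⟨0, mem_range.mpr hn⟩
  obtain ⟨k, rfl⟩ := Nat.exists_eq_add_of_lt (mem_range.mp hi)
  rw [add_right_comm] at *
  have h1 := norm_prod_add_ge_factorial (x : ℚ_[q]) i k fun l hl => hmin l (mem_range.mpr hl)
  have h2 := norm_add_natCast_ge hx h (i := i) (B := B)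
    ((Nat.add_le_add_left (Nat.mul_le_mul_left _ (by omega)) _).trans hB)
  have h3 : ‖((poch x (i + 1 + k) : ℚ) : ℚ_[q])‖ = ∏ l ∈ range (i + 1 + k), ‖(x : ℚ_[q]) + l‖ := by
    rw [poch, Rat.cast_prod, norm_prod]; simp
  rw [h3]
  have hpos : (0 : ℝ) < (q : ℝ) ^ Nat.log q B := by positivity
  have h4 := mul_le_mul_of_nonneg_left h2
    (norm_nonneg ((i + 1 + k).factorial : ℚ_[q]))
  have h5 := h4.trans h1
  rwa [← div_eq_mul_inv, div_le_iff₀ hpos] at h5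

theorem norm_prod_prime_pow {T : Finset ℕ} (hT : ∀ r ∈ T, r.Prime) (f : ℕ → ℕ) :
    ‖((∏ r ∈ T, r ^ f r : ℕ) : ℚ_[q])‖ = if q ∈ T then ((q : ℝ) ^ f q)⁻¹ else 1 := by
  have hne : ∀ r ∈ T, r ≠ q → ‖((r ^ f r : ℕ) : ℚ_[q])‖ = 1 := fun r hr hrq => by
    rw [Padic.norm_natCast_eq_one_iff]
    exact ((Nat.coprime_primes Fact.out (hT r hr)).mpr hrq.symm).pow_right _
  rw [Nat.cast_prod, norm_prod]
  split_ifs with hq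
  · rw [prod_eq_single_of_mem q hq hne]
    simp
  · exact prod_eq_one fun r hr => hne r hr fun h => hq (h ▸ hr)

end Local

/-! ### Integrality from local bounds; the factors `factorialPart` and `lcmUpTo`. -/

theorem exists_int_eq_of_norm_le_one {x : ℚ}
    (h : ∀ (q : ℕ) [Fact q.Prime], ‖(x : ℚ_[q])‖ ≤ 1) : ∃ z : ℤ, x = z := by
  refine ⟨x.num, ?_⟩
  have hd : x.den = 1 := by
    by_contra hne
    have : Fact (x.den.minFac).Prime := ⟨Nat.minFac_prime hne⟩
    exact absurd (h x.den.minFac) (not_le.mpr (one_lt_norm_of_dvd_den (Nat.minFac_dvd _)))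
  exact (Rat.coe_int_num_of_den_eq_one hd).symm

/-- The part of `n!` composed of the primes dividing `s`. -/
def factorialPart (s n : ℕ) : ℕ := ∏ q ∈ s.primeFactors, q ^ padicValNat q n.factorial

theorem factorialPart_pos (s n : ℕ) : 0 < factorialPart s n :=
  prod_pos fun _ hq => pow_pos (Nat.prime_of_mem_primeFactors hq).pos _

theorem norm_natCast_eq_inv_pow_padicValNat {q : ℕ} [Fact q.Prime] {n : ℕ} (hn : n ≠ 0) :
    ‖(n : ℚ_[q])‖ = ((q : ℝ) ^ padicValNat q n)⁻¹ := by
  rw [Padic.norm_eq_zpow_neg_valuation (by exact_mod_cast hn), Padic.valuation_natCast]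
  simp

theorem norm_factorialPart {q : ℕ} [Fact q.Prime] {s : ℕ} (n : ℕ) (hs : s ≠ 0) (h : q ∣ s) :
    ‖(factorialPart s n : ℚ_[q])‖ = ‖(n.factorial : ℚ_[q])‖ := by
  rw [factorialPart, norm_prod_prime_pow fun _ hr => Nat.prime_of_mem_primeFactors hr,
    if_pos (Nat.mem_primeFactors.mpr ⟨Fact.out, h, hs⟩),
    norm_natCast_eq_inv_pow_padicValNat n.factorial_ne_zero]

theorem norm_factorialPart_of_not_dvd {q : ℕ} [Fact q.Prime] {s : ℕ} (n : ℕ) (h : ¬ q ∣ s) :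
    ‖(factorialPart s n : ℚ_[q])‖ = 1 := by
  rw [factorialPart, norm_prod_prime_pow fun _ hr => Nat.prime_of_mem_primeFactors hr,
    if_neg fun hm => h (Nat.dvd_of_mem_primeFactors hm)]

theorem eps_pos (n : ℕ) : 0 < eps n :=
  prod_pos fun q hq => Real.rpow_pos_of_pos (by exact_mod_cast (Nat.prime_of_mem_primeFactors hq).pos) _

theorem one_le_eps_factor {q : ℕ} (hq : q.Prime) : 1 ≤ (q : ℝ) ^ (1 / ((q : ℝ) - 1)) := by
  have h2 : (2 : ℝ) ≤ q := by exact_mod_cast hq.two_le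
  exact Real.one_le_rpow (by linarith) (by apply div_nonneg <;> linarith)

theorem one_le_eps (n : ℕ) : 1 ≤ eps n :=
  Finset.one_le_prod fun _ hq => one_le_eps_factor (Nat.prime_of_mem_primeFactors hq)

theorem eps_le_eps_of_dvd {m n : ℕ} (h : m ∣ n) (hn : n ≠ 0) : eps m ≤ eps n :=
  Finset.prod_le_prod_of_subset_of_one_le (Nat.primeFactors_mono h hn)
    (fun q hq => by positivity)
    fun _ hq _ => one_le_eps_factor (Nat.prime_of_mem_primeFactors hq)

/-- Legendre's formula gives `v_q(n!) ≤ n / (q - 1)`, which is where the exponents in `eps` come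
from. -/
theorem factorialPart_le (s n : ℕ) : (factorialPart s n : ℝ) ≤ eps s ^ n := by
  rw [factorialPart, eps, ← prod_pow, Nat.cast_prod]
  refine prod_le_prod (fun _ _ => by positivity) fun q hq => ?_
  have hp := Nat.prime_of_mem_primeFactors hq
  have : Fact q.Prime := ⟨hp⟩
  have h2 : (2 : ℝ) ≤ q := by exact_mod_cast hp.two_le
  have h := sub_one_mul_padicValNat_factorial (p := q) n
  have h' : (q - 1) * padicValNat q n.factorial ≤ n := by omega
  have h'' : ((q : ℝ) - 1) * padicValNat q n.factorial ≤ n := by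
    have : (((q - 1) * padicValNat q n.factorial : ℕ) : ℝ) ≤ n := by exact_mod_cast h'
    rwa [Nat.cast_mul, Nat.cast_sub hp.one_le, Nat.cast_one] at this
  rw [← Real.rpow_natCast (_ ^ _), ← Real.rpow_mul (by linarith), Nat.cast_pow, ← Real.rpow_natCast]
  refine Real.rpow_le_rpow_of_exponent_le (by linarith) ?_
  rw [one_div_mul_eq_div, le_div_iff₀ (by linarith)]
  linarith

/-- The least common multiple of `1, …, x`, written as a product of prime powers. -/
def lcmUpTo (x : ℕ) : ℕ := ∏ q ∈ (range (x + 1)).filter Nat.Prime, q ^ Nat.log q x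

theorem lcmUpTo_pos (x : ℕ) : 0 < lcmUpTo x :=
  prod_pos fun _ hq => pow_pos (mem_filter.mp hq).2.pos _

theorem norm_lcmUpTo {q : ℕ} [Fact q.Prime] (x : ℕ) :
    ‖(lcmUpTo x : ℚ_[q])‖ = ((q : ℝ) ^ Nat.log q x)⁻¹ := by
  rw [lcmUpTo, norm_prod_prime_pow fun _ hr => (mem_filter.mp hr).2]
  split_ifs with h
  · rfl
  · have hx : x < q := by
      by_contra hc
      exact h (mem_filter.mpr ⟨mem_range.mpr (by omega), Fact.out⟩)
    rw [Nat.log_of_lt hx]; simp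

/-- Each of the `π(x)` prime powers is at most `x`, so the product is at most `exp (π(x) log x)`. -/
theorem lcmUpTo_le {θ c : ℝ} (h : AdmissiblePrimeBound θ c) {x : ℕ} (hx : c ≤ x) :
    (lcmUpTo x : ℝ) ≤ Real.exp (θ * x) := by
  obtain ⟨_, hc, hπ⟩ := h
  have hx1 : (1 : ℝ) < x := hc.trans_le hx
  have hx0 : x ≠ 0 := by rintro rfl; norm_num at hx1
  have h1 : lcmUpTo x ≤ x ^ Nat.primeCounting x := by
    rw [lcmUpTo, ← Nat.primesLE_card_eq_primeCounting, ← prod_const]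
    refine prod_le_prod' fun q _ => Nat.pow_log_le_self q hx0
  have h2 := hπ x hx
  rw [Nat.floor_natCast] at h2
  have hlog : 0 < Real.log x := Real.log_pos hx1
  calc (lcmUpTo x : ℝ) ≤ (x : ℝ) ^ Nat.primeCounting x := by exact_mod_cast h1
    _ = Real.exp (Nat.primeCounting x * Real.log x) := by
      rw [mul_comm, Real.exp_mul, Real.exp_log (by linarith), Real.rpow_natCast]
    _ ≤ Real.exp (θ * x) := by
      refine Real.exp_le_exp.mpr ?_
      calc _ ≤ θ * (x / Real.log x) * Real.log x := by gcongr
        _ = θ * x := by field_simp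

/-! ### Coefficients of `(X - 1) ^ e φ` and Newton interpolation. -/

open Polynomial

/-- The coefficients `(x)_l / (x + α₀)_l` of the series `φ`. -/
def phiCoeff (α₀ x : ℚ) (l : ℕ) : ℚ := poch x l / poch (x + α₀) l

/-- The series `φ` as a formal power series. -/
noncomputable def phiSeries (α₀ x : ℚ) : PowerSeries ℚ := PowerSeries.mk (phiCoeff α₀ x)

theorem coeff_phiSeries (α₀ x : ℚ) (l : ℕ) :
    PowerSeries.coeff l (phiSeries α₀ x) = phiCoeff α₀ x l := PowerSeries.coeff_mk _ _

theorem coeff_succ_X_sub_one_mul (f : PowerSeries ℚ) (k : ℕ) :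
    PowerSeries.coeff (k + 1) ((PowerSeries.X - 1) * f) =
      PowerSeries.coeff k f - PowerSeries.coeff (k + 1) f := by
  rw [sub_mul, one_mul, map_sub, PowerSeries.coeff_succ_X_mul]

/-- Multiplication by `X - 1` takes differences, and these stay hypergeometric. The denominator
depends only on `t + e`, so terms with different powers of `X - 1` can be summed at a common index.
-/
theorem coeff_X_sub_one_pow_mul_phiSeries {α₀ x : ℚ} (h₀ : 0 < α₀) (hx : 0 < x) (e t : ℕ) :
    PowerSeries.coeff (t + e) ((PowerSeries.X - 1) ^ e * phiSeries α₀ x) =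
      poch x t * poch α₀ e / poch (x + α₀) (t + e) := by
  induction e generalizing t with
  | zero => simp [coeff_phiSeries, phiCoeff, poch_zero]
  | succ e ih =>
    rw [pow_succ', mul_assoc, ← add_assoc, coeff_succ_X_sub_one_mul, ih t,
      show t + e + 1 = (t + 1) + e by ring, ih (t + 1), show t + 1 + e = (t + e) + 1 by ring,
      poch_succ, poch_succ, poch_succ]
    have h1 := (poch_pos (add_pos hx h₀) (t + e)).ne'
    have h2 : (x + α₀ + (t + e : ℕ) : ℚ) ≠ 0 := by positivity
    field_simp
    push_cast
    ring

theorem abs_coeff_X_sub_one_pow_mul_le {f : PowerSeries ℚ} (hf : ∀ k, |PowerSeries.coeff k f| ≤ 1)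
    (e k : ℕ) : |PowerSeries.coeff k ((PowerSeries.X - 1) ^ e * f)| ≤ 2 ^ e := by
  induction e generalizing k with
  | zero => simpa using hf k
  | succ e ih =>
    rw [pow_succ', mul_assoc]
    cases k with
    | zero =>
      rw [sub_mul, one_mul, map_sub, PowerSeries.coeff_zero_X_mul, zero_sub, abs_neg]
      refine (ih 0).trans ?_
      rw [pow_succ]; linarith [pow_pos (zero_lt_two' ℚ) e]
    | succ k =>
      rw [coeff_succ_X_sub_one_mul]
      refine (abs_sub _ _).trans ?_
      rw [pow_succ]; linarith [ih k, ih (k + 1)]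

theorem abs_phiCoeff_le_one {α₀ x : ℚ} (h₀ : 0 < α₀) (hx : 0 < x) (l : ℕ) :
    |phiCoeff α₀ x l| ≤ 1 := by
  have h1 := poch_pos hx l
  have h2 := poch_mono hx.le (le_add_of_nonneg_right h₀.le : x ≤ x + α₀) l
  rw [phiCoeff, abs_of_nonneg (div_nonneg h1.le (h1.trans_le h2).le)]
  exact div_le_one_of_le₀ h2 (h1.trans_le h2).le

/-- The coefficients of a polynomial in the basis of binomial coefficients. -/
def newtonCoeff (P : ℚ[X]) (l : ℕ) : ℚ :=
  ∑ k ∈ range (l + 1), ((-1) ^ (l - k) * l.choose k : ℤ) * P.eval (k : ℚ)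

theorem newtonCoeff_eq_fwdDiff (P : ℚ[X]) (l : ℕ) :
    newtonCoeff P l = (fwdDiff 1)^[l] (fun x => eval x P) 0 := by
  rw [fwdDiff_iter_eq_sum_shift, newtonCoeff]
  refine sum_congr rfl fun k _ => ?_
  simp [zsmul_eq_mul]

/-- Newton's forward difference formula at `-x`, since `(-1) ^ l (x)_l / l!` is the binomial
coefficient of `-x` over `l`. -/
theorem sum_newtonCoeff_mul_poch {P : ℚ[X]} {N : ℕ} (hP : P.natDegree ≤ N) (x : ℚ) :
    ∑ l ∈ range (N + 1), newtonCoeff P l * ((-1) ^ l * poch x l / l.factorial) =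
      P.eval (-x) := by
  have hPQ : P = ∑ l ∈ range (N + 1), C (newtonCoeff P l / l.factorial) * descPochhammer ℚ l := by
    refine Polynomial.eq_of_infinite_eval_eq _ _
      ((Set.infinite_range_of_injective (Nat.cast_injective (R := ℚ))).mono ?_)
    rintro _ ⟨n, rfl⟩
    have h1 := shift_eq_sum_fwdDiff_iter (1 : ℚ) (fun x => eval x P) n 0
    simp only [← newtonCoeff_eq_fwdDiff, zero_add, nsmul_eq_mul, mul_one] at h1
    simp only [Set.mem_ofPred_eq]
    rw [h1, eval_finsetSum]
    -- Both sums extend to a common length: binomial coefficients vanish for `l > n`, and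
    -- differences of order `l > N` annihilate `P`.
    have h2 : ∀ K, n ≤ K → N ≤ K → ∀ f : ℕ → ℚ, (∀ l, f l = (n.choose l : ℚ) * newtonCoeff P l) →
        ∑ l ∈ range (n + 1), f l = ∑ l ∈ range (K + 1), f l ∧
        ∑ l ∈ range (N + 1), f l = ∑ l ∈ range (K + 1), f l := by
      intro K hn hN f hf
      constructor
      · refine sum_subset (range_mono (by omega)) fun l _ hl => ?_
        rw [hf, Nat.choose_eq_zero_of_lt (by simpa using hl)]; simp
      · refine sum_subset (range_mono (by omega)) fun l _ hl => ?_
        rw [hf, newtonCoeff_eq_fwdDiff, fwdDiff_iter_eq_zero_of_degree_lt]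
        · simp
        · exact hP.trans_lt (by simpa using hl)
    obtain ⟨h3, h4⟩ := h2 (max n N) (le_max_left _ _) (le_max_right _ _) _ fun _ => rfl
    rw [h3, ← h4]
    refine sum_congr rfl fun l _ => ?_
    rw [eval_mul, eval_C, Nat.cast_choose_eq_descPochhammer_div]
    ring
  conv_rhs => rw [hPQ]
  rw [eval_finsetSum]
  refine sum_congr rfl fun l _ => ?_
  have h := ascPochhammer_eval_neg_eq_descPochhammer ℚ (-x) l
  rw [neg_neg, ascPochhammer_eval_eq_poch] at h
  rw [eval_mul, eval_C, h, ← mul_assoc ((-1 : ℚ) ^ l), ← mul_pow]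
  norm_num
  ring

/-! ### Construction of the Padé approximations. -/

section Pade

variable {m : ℕ} (α₀ : ℚ) (α : Fin m → ℚ) (ν : Fin (m + 1) → ℕ)

/-- The degree `ν₁ + ⋯ + ν_m` of the denominator of the Padé approximation of index `ν`. -/
def padeDegree (ν : Fin (m + 1) → ℕ) : ℕ := ∑ j : Fin m, ν j.succ

/-- The polynomial `∏ (α_j + ν₀ - ν_j + X)_{ν_j} / ν_j!`. -/
noncomputable def nodePoly : ℚ[X] :=
  ∏ j : Fin m, C ((ν j.succ).factorial : ℚ)⁻¹ *
    (ascPochhammer ℚ (ν j.succ)).comp (X + C (α j + ν 0 - ν j.succ))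

theorem eval_nodePoly (x : ℚ) : (nodePoly α ν).eval x =
    ∏ j : Fin m, poch (α j + ν 0 - ν j.succ + x) (ν j.succ) / (ν j.succ).factorial := by
  rw [nodePoly, eval_prod]
  refine prod_congr rfl fun j _ => ?_
  rw [eval_mul, eval_C, eval_comp, ascPochhammer_eval_eq_poch, eval_add, eval_X, eval_C,
    add_comm x]
  ring

theorem natDegree_nodePoly_le : (nodePoly α ν).natDegree ≤ padeDegree ν := by
  refine (natDegree_prod_le _ _).trans (sum_le_sum fun j _ => ?_)
  refine (natDegree_C_mul_le _ _).trans ?_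
  refine natDegree_comp_le.trans ?_
  rw [ascPochhammer_natDegree, natDegree_X_add_C, mul_one]

/-- The coefficients of the Padé denominator in powers of `X - 1`. -/
noncomputable def padeCoeff (l : ℕ) : ℚ :=
  (-1) ^ l * (poch (α₀ + padeDegree ν - l) l / l.factorial) * newtonCoeff (nodePoly α ν) l

/-- The common denominator of the Padé approximations of index `ν` to the series `φ_j`. -/
noncomputable def padeQ : ℚ[X] :=
  ∑ l ∈ range (padeDegree ν + 1), C (padeCoeff α₀ α ν l) * (X - 1) ^ (padeDegree ν - l)

/-- The numerators of the Padé approximations of index `ν`. -/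
noncomputable def padeP (j : Fin m) : ℚ[X] :=
  PowerSeries.trunc (∑ i, ν i - ν j.succ) ((padeQ α₀ α ν : PowerSeries ℚ) * phiSeries α₀ (α j))

theorem sum_eq_padeDegree_add : ∑ i, ν i = padeDegree ν + ν 0 := by
  rw [Fin.sum_univ_succ, padeDegree, add_comm]

theorem coe_padeQ_mul (f : PowerSeries ℚ) : (padeQ α₀ α ν : PowerSeries ℚ) * f =
    ∑ l ∈ range (padeDegree ν + 1), PowerSeries.C (padeCoeff α₀ α ν l) *
      ((PowerSeries.X - 1) ^ (padeDegree ν - l) * f) := by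
  have h : (padeQ α₀ α ν : PowerSeries ℚ) = Polynomial.coeToPowerSeries.ringHom (padeQ α₀ α ν) := rfl
  rw [h, padeQ, map_sum, sum_mul]
  refine sum_congr rfl fun l _ => ?_
  simp [mul_assoc]

variable {α₀ α}

/-- The factor `(α₀ + N - l)_l` in `padeCoeff` completes `(α₀)_{N - l}` to `(α₀)_N`. What still
depends on `l` is `(α_j + t)_l`, and the sum over `l` is the Newton expansion of `nodePoly` at
`-(α_j + t)`. -/
theorem coeff_padeQ_mul_phiSeries (h₀ : 0 < α₀) (hα : ∀ j, 0 < α j) (j : Fin m) (t : ℕ) :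
    PowerSeries.coeff (t + padeDegree ν) ((padeQ α₀ α ν : PowerSeries ℚ) * phiSeries α₀ (α j)) =
      poch (α j) t * poch α₀ (padeDegree ν) / poch (α j + α₀) (t + padeDegree ν) *
        (nodePoly α ν).eval (-(α j + t)) := by
  rw [coe_padeQ_mul, map_sum, ← sum_newtonCoeff_mul_poch (natDegree_nodePoly_le α ν), mul_sum]
  refine sum_congr rfl fun l hl => ?_
  have hl : l ≤ padeDegree ν := by simpa [Nat.lt_succ_iff] using hl
  have h1 := coeff_X_sub_one_pow_mul_phiSeries h₀ (hα j) (padeDegree ν - l) (t + l)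
  rw [show t + l + (padeDegree ν - l) = t + padeDegree ν by omega] at h1
  have h2 := poch_add α₀ (padeDegree ν - l) l
  rw [Nat.sub_add_cancel hl, Nat.cast_sub hl, ← add_sub_assoc] at h2
  rw [PowerSeries.coeff_C_mul, h1, h2, padeCoeff, poch_add]
  ring

theorem poch_neg_natCast_eq_zero {k n : ℕ} (h : k < n) : poch (-(k : ℚ)) n = 0 :=
  prod_eq_zero (mem_range.mpr h) (by ring)

theorem X_pow_dvd_padeQ_mul_sub (h₀ : 0 < α₀) (hα : ∀ j, 0 < α j) (hν : ∀ j : Fin m, ν j.succ ≤ ν 0)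
    (j : Fin m) : PowerSeries.X ^ (∑ i, ν i) ∣
      (padeQ α₀ α ν : PowerSeries ℚ) * phiSeries α₀ (α j) - (padeP α₀ α ν j : PowerSeries ℚ) := by
  rw [PowerSeries.X_pow_dvd_iff]
  intro k hk
  rw [map_sub, Polynomial.coeff_coe, padeP, PowerSeries.coeff_trunc]
  split_ifs with h
  · exact sub_self _
  · have h1 := sum_eq_padeDegree_add ν
    have h2 := hν j
    obtain ⟨t, rfl⟩ : ∃ t, k = t + padeDegree ν := ⟨k - padeDegree ν, by omega⟩
    rw [coeff_padeQ_mul_phiSeries ν h₀ hα, eval_nodePoly, sub_zero]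
    -- For `ν₀ - ν_j ≤ t < ν₀` the `j`-th factor of `nodePoly` is a rising factorial of length `ν_j`
    -- that starts at the nonpositive integer `ν₀ - ν_j - t > -ν_j`, so it contains zero.
    refine mul_eq_zero_of_right _ (prod_eq_zero (mem_univ j) ?_)
    rw [show α j + ν 0 - ν j.succ + -(α j + t) = -((t + ν j.succ - ν 0 : ℕ) : ℚ) by
      rw [Nat.cast_sub (by omega)]; push_cast; ring, poch_neg_natCast_eq_zero (by omega), zero_div]

theorem natDegree_padeQ_le : (padeQ α₀ α ν).natDegree ≤ padeDegree ν := by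
  refine natDegree_sum_le_of_forall_le _ _ fun l _ => ?_
  refine (natDegree_C_mul_le _ _).trans ((natDegree_pow_le_of_le _ (natDegree_X_sub_C_le 1)).trans ?_)
  omega

theorem natDegree_X_sub_one_pow_le (k : ℕ) : ((X - 1 : ℚ[X]) ^ k).natDegree ≤ k :=
  (natDegree_pow_le_of_le k (natDegree_X_sub_C_le 1)).trans (by omega)

/-- Only `l = 0` reaches degree `N`, and its coefficient is `nodePoly` at `0`, a product of positive
numbers. -/
theorem coeff_padeQ_top (hα : ∀ j, 0 < α j) (hν : ∀ j : Fin m, ν j.succ ≤ ν 0) :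
    (padeQ α₀ α ν).coeff (padeDegree ν) ≠ 0 := by
  have h1 : (padeQ α₀ α ν).coeff (padeDegree ν) = padeCoeff α₀ α ν 0 := by
    rw [padeQ, finsetSum_coeff, sum_eq_single_of_mem 0 (by simp)]
    · have h : ((X - 1 : ℚ[X]) ^ padeDegree ν).Monic := (monic_X_sub_C (1 : ℚ)).pow _
      have hd : ((X - 1 : ℚ[X]) ^ padeDegree ν).natDegree = padeDegree ν := by
        have := natDegree_pow (X - 1 : ℚ[X]) (padeDegree ν)
        rwa [show (X - 1 : ℚ[X]) = X - C 1 by simp, natDegree_X_sub_C, mul_one] at this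
      have h2 := h.coeff_natDegree
      rw [hd] at h2
      rw [coeff_C_mul, Nat.sub_zero, h2, mul_one]
    · intro l hl hl0
      rw [coeff_C_mul, coeff_eq_zero_of_natDegree_lt, mul_zero]
      refine (natDegree_X_sub_one_pow_le _).trans_lt ?_
      have := mem_range.mp hl
      omega
  have h3 : padeCoeff α₀ α ν 0 = (nodePoly α ν).eval 0 := by
    simp [padeCoeff, newtonCoeff, poch_zero]
  rw [h1, h3, eval_nodePoly]
  refine prod_ne_zero_iff.mpr fun j _ => ne_of_gt (div_pos (poch_pos ?_ _)
    (Nat.cast_pos.mpr (Nat.factorial_pos _)))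
  have h2 : (ν j.succ : ℚ) ≤ ν 0 := by exact_mod_cast hν j
  linarith [hα j, h2]

end Pade

/-! ### The determinant of the lowered approximations is a nonzero monomial. -/

theorem coeff_prod_sum_of_natDegree_le {ι : Type*} (s : Finset ι) (f : ι → ℚ[X]) (d : ι → ℕ)
    (h : ∀ i ∈ s, (f i).natDegree ≤ d i) :
    (∏ i ∈ s, f i).coeff (∑ i ∈ s, d i) = ∏ i ∈ s, (f i).coeff (d i) := by
  classical
  induction s using Finset.induction_on with
  | empty => simp
  | insert a s ha ih =>
    rw [prod_insert ha, sum_insert ha, prod_insert ha,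
      coeff_mul_add_eq_of_natDegree_le (h a (mem_insert_self _ _)),
      ih fun i hi => h i (mem_insert_of_mem hi)]
    exact (natDegree_prod_le _ _).trans (sum_le_sum fun i hi => h i (mem_insert_of_mem hi))

/-- The degree is at most `∑ d k` and the order at `0` is at least `∑ d k`, so one monomial remains.
Its coefficient comes from the identity permutation, as only diagonal entries attain the row
degrees. -/
theorem det_eq_monomial {n : ℕ} (A : Matrix (Fin n) (Fin n) ℚ[X]) (d : Fin n → ℕ)
    (hdeg : ∀ k i, (A k i).natDegree ≤ d k) (hoff : ∀ k i, i ≠ k → (A k i).coeff (d k) = 0)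
    (hdvd : PowerSeries.X ^ (∑ k, d k) ∣ (A.det : PowerSeries ℚ)) :
    A.det = C (∏ k, (A k k).coeff (d k)) * X ^ (∑ k, d k) := by
  have hdet : A.det = ∑ σ : Equiv.Perm (Fin n), Equiv.Perm.sign σ • ∏ i, A i (σ i) := by
    rw [← Matrix.det_transpose, Matrix.det_apply]; rfl
  ext e
  rw [coeff_C_mul, coeff_X_pow]
  rcases lt_trichotomy e (∑ k, d k) with he | rfl | he
  · rw [if_neg he.ne, mul_zero]
    rw [← Polynomial.coeff_coe]
    exact PowerSeries.X_pow_dvd_iff.mp hdvd e he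
  · rw [if_pos rfl, mul_one, hdet, finsetSum_coeff, sum_eq_single (1 : Equiv.Perm (Fin n))]
    · rw [Equiv.Perm.sign_one, one_smul]
      exact coeff_prod_sum_of_natDegree_le _ _ _ fun i _ => hdeg _ _
    · intro σ _ hσ
      obtain ⟨i, hi⟩ : ∃ i, σ i ≠ i := by
        by_contra hc; push Not at hc; exact hσ (Equiv.ext hc)
      rw [coeff_smul, coeff_prod_sum_of_natDegree_le _ _ _ fun i _ => hdeg _ _,
        prod_eq_zero (mem_univ i) (hoff _ _ hi), smul_zero]
    · simp
  · rw [if_neg he.ne', mul_zero]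
    refine coeff_eq_zero_of_natDegree_lt (lt_of_le_of_lt ?_ he)
    rw [hdet]
    refine natDegree_sum_le_of_forall_le _ _ fun σ _ => ?_
    refine (natDegree_smul_le _ _).trans ?_
    exact (natDegree_prod_le _ _).trans (sum_le_sum fun i _ => hdeg _ _)

section

variable {m : ℕ} {α₀ : ℚ} {α : Fin m → ℚ}

/-- The index `ν` lowered by one at the place `i`. -/
def lowerIndex (ν : Fin (m + 1) → ℕ) (i k : Fin (m + 1)) : ℕ := if k = i then ν k - 1 else ν k

/-- The column `(Q, P₁, …, P_m)` of the Padé approximation of index `ν`. -/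
noncomputable def padeVec (α₀ : ℚ) (α : Fin m → ℚ) (ν : Fin (m + 1) → ℕ) : Fin (m + 1) → ℚ[X] :=
  Fin.cons (padeQ α₀ α ν) (padeP α₀ α ν)

theorem lowerIndex_add_ite {ν : Fin (m + 1) → ℕ} (hν : ∀ i, 1 ≤ ν i) (i k : Fin (m + 1)) :
    lowerIndex ν i k + (if k = i then 1 else 0) = ν k := by
  unfold lowerIndex
  have := hν k
  split_ifs <;> omega

theorem sum_lowerIndex_add_one {ν : Fin (m + 1) → ℕ} (hν : ∀ i, 1 ≤ ν i) (i : Fin (m + 1)) :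
    ∑ k, lowerIndex ν i k + 1 = ∑ k, ν k := by
  rw [← sum_congr rfl fun k _ => lowerIndex_add_ite hν i k, sum_add_distrib]
  simp

theorem padeDegree_lowerIndex_zero (ν : Fin (m + 1) → ℕ) :
    padeDegree (lowerIndex ν 0) = padeDegree ν :=
  sum_congr rfl fun j _ => if_neg (Fin.succ_ne_zero j)

theorem padeDegree_lowerIndex_succ {ν : Fin (m + 1) → ℕ} (hν : ∀ i, 1 ≤ ν i) (j : Fin m) :
    padeDegree (lowerIndex ν j.succ) + 1 = padeDegree ν := by
  have h1 := sum_lowerIndex_add_one hν j.succ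
  rw [sum_eq_padeDegree_add, sum_eq_padeDegree_add] at h1
  have h2 : lowerIndex ν j.succ 0 = ν 0 := if_neg (Fin.succ_ne_zero j).symm
  omega

theorem lowerIndex_succ_le {ν : Fin (m + 1) → ℕ} (h0 : ∀ j : Fin m, ν j.succ + 1 ≤ ν 0)
    (i : Fin (m + 1)) (j : Fin m) : lowerIndex ν i j.succ ≤ lowerIndex ν i 0 := by
  have := h0 j
  unfold lowerIndex
  split_ifs with h1 h2 <;> omega

theorem natDegree_padeP_le (ν : Fin (m + 1) → ℕ) (j : Fin m) :
    (padeP α₀ α ν j).natDegree ≤ ∑ i, ν i - ν j.succ - 1 := by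
  rw [natDegree_le_iff_coeff_eq_zero]
  intro k hk
  rw [padeP, PowerSeries.coeff_trunc, if_neg (by omega)]

/-- Lowering `ν` at `j` shortens the block of vanishing coefficients by one at its lower end, `t =
ν₀ - ν_j`. There the `j`-th factor of `nodePoly` is positive, while a zero of the `i`-th factor
would make `α_i - α_j` an integer. -/
theorem coeff_padeP_lowerIndex_ne_zero (h₀ : 0 < α₀) (hα : ∀ j, 0 < α j)
    (hdiff : ∀ i j : Fin m, i ≠ j → ∀ k : ℤ, α i - α j ≠ k) {ν : Fin (m + 1) → ℕ}
    (hν : ∀ i, 1 ≤ ν i) (h0 : ∀ j : Fin m, ν j.succ + 1 ≤ ν 0) (j : Fin m) :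
    (padeP α₀ α (lowerIndex ν j.succ) j).coeff (∑ k, ν k - 1 - ν j.succ) ≠ 0 := by
  have h1 := sum_lowerIndex_add_one hν j.succ
  have h2 := padeDegree_lowerIndex_succ hν j
  have h3 := sum_eq_padeDegree_add ν
  have h4 := h0 j
  have h5 := hν j.succ
  have h6 : lowerIndex ν j.succ j.succ = ν j.succ - 1 := if_pos rfl
  have h7 : lowerIndex ν j.succ 0 = ν 0 := if_neg (Fin.succ_ne_zero j).symm
  rw [padeP, PowerSeries.coeff_trunc, if_pos (by omega),
    show ∑ k, ν k - 1 - ν j.succ = (ν 0 - ν j.succ) + padeDegree (lowerIndex ν j.succ) by omega,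
    coeff_padeQ_mul_phiSeries _ h₀ hα]
  refine mul_ne_zero (div_ne_zero (mul_ne_zero (poch_pos (hα j) _).ne' (poch_pos h₀ _).ne')
    (poch_pos (add_pos (hα j) h₀) _).ne') ?_
  rw [eval_nodePoly, prod_ne_zero_iff]
  intro i _
  refine div_ne_zero (prod_ne_zero_iff.mpr fun t _ => ?_) (by exact_mod_cast Nat.factorial_ne_zero _)
  rw [h7]
  rcases eq_or_ne i j with rfl | hij
  · rw [h6, Nat.cast_sub h5, Nat.cast_sub (by omega)]
    have : (0 : ℚ) < 1 + t := by positivity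
    refine ne_of_gt (this.trans_eq ?_)
    push_cast; ring
  · intro hc
    refine hdiff i j hij (lowerIndex ν j.succ i.succ - ν j.succ - t) ?_
    rw [Nat.cast_sub (by omega)] at hc
    push_cast
    linear_combination hc

theorem det_padeVec_ne_zero (h₀ : 0 < α₀) (hα : ∀ j, 0 < α j)
    (hdiff : ∀ i j : Fin m, i ≠ j → ∀ k : ℤ, α i - α j ≠ k) {ν : Fin (m + 1) → ℕ}
    (hν : ∀ i, 1 ≤ ν i) (h0 : ∀ j : Fin m, ν j.succ + 1 ≤ ν 0) :
    ∃ (c : ℚ) (K : ℕ), c ≠ 0 ∧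
      (Matrix.of fun k i => padeVec α₀ α (lowerIndex ν i) k).det = C c * X ^ K := by
  set A : Matrix (Fin (m + 1)) (Fin (m + 1)) ℚ[X] :=
    Matrix.of fun k i => padeVec α₀ α (lowerIndex ν i) k with hA
  have hA0 : ∀ i, A 0 i = padeQ α₀ α (lowerIndex ν i) := fun i => rfl
  have hAs : ∀ j i, A (Fin.succ j) i = padeP α₀ α (lowerIndex ν i) j := fun j i => rfl
  let d : Fin (m + 1) → ℕ := Fin.cons (padeDegree ν) fun j => ∑ k, ν k - 1 - ν j.succ
  have hd0 : d 0 = padeDegree ν := rfl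
  have hds : ∀ j : Fin m, d j.succ = ∑ k, ν k - 1 - ν j.succ := fun j => rfl
  have hM := sum_eq_padeDegree_add ν
  have hle : ∀ j : Fin m, ν j.succ ≤ ∑ k, ν k - 1 := fun j => by have := h0 j; omega
  refine ⟨∏ k, (A k k).coeff (d k), ∑ k, d k, ?_, det_eq_monomial A d ?_ ?_ ?_⟩
  · refine prod_ne_zero_iff.mpr fun k _ => ?_
    induction k using Fin.cases with
    | zero =>
      rw [hA0, hd0, ← padeDegree_lowerIndex_zero]
      exact coeff_padeQ_top _ hα (lowerIndex_succ_le h0 0)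
    | succ j =>
      rw [hAs, hds]
      exact coeff_padeP_lowerIndex_ne_zero h₀ hα hdiff hν h0 j
  · intro k i
    induction k using Fin.cases with
    | zero =>
      rw [hA0, hd0]
      refine (natDegree_padeQ_le _).trans ?_
      induction i using Fin.cases with
      | zero => rw [padeDegree_lowerIndex_zero]
      | succ j => have := padeDegree_lowerIndex_succ hν j; omega
    | succ j =>
      rw [hAs, hds]
      refine (natDegree_padeP_le _ _).trans ?_
      have h1 := sum_lowerIndex_add_one hν i
      have h2 := lowerIndex_add_ite hν i j.succ
      split_ifs at h2 <;> omega
  · intro k i hik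
    refine coeff_eq_zero_of_natDegree_lt ?_
    induction k using Fin.cases with
    | zero =>
      rw [hA0, hd0]
      refine (natDegree_padeQ_le _).trans_lt ?_
      obtain ⟨j, rfl⟩ := Fin.exists_succ_eq.mpr hik
      have := padeDegree_lowerIndex_succ hν j
      omega
    | succ j =>
      rw [hAs, hds]
      refine (natDegree_padeP_le _ _).trans_lt ?_
      have h1 := sum_lowerIndex_add_one hν i
      have h2 := lowerIndex_add_ite hν i j.succ
      rw [if_neg hik.symm] at h2
      have h3 := hle j
      have h4 := h0 j
      have h5 := hν j.succ
      have h6 : ν 0 + ν j.succ ≤ ∑ k, ν k := by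
        rw [Fin.sum_univ_succ]
        exact Nat.add_le_add_left (single_le_sum (f := fun j : Fin m => ν j.succ)
          (fun _ _ => Nat.zero_le _) (mem_univ j)) _
      omega
  · choose R hR using fun (i : Fin (m + 1)) (j : Fin m) =>
      X_pow_dvd_padeQ_mul_sub (lowerIndex ν i) h₀ hα (lowerIndex_succ_le h0 i) j
    have hsum : ∀ i, ∑ k, lowerIndex ν i k = ∑ k, ν k - 1 := fun i => by
      have := sum_lowerIndex_add_one hν i; omega
    let B : Matrix (Fin (m + 1)) (Fin (m + 1)) (PowerSeries ℚ) :=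
      Matrix.of fun k i => (Fin.cons (padeQ α₀ α (lowerIndex ν i) : PowerSeries ℚ)
        (fun j => -R i j) : Fin (m + 1) → PowerSeries ℚ) k
    -- Subtracting `φ_j` times the first row leaves the remainders, so each of the other `m` rows is
    -- divisible by `X ^ (∑ ν - 1)`. The resulting order `m (∑ ν - 1)` equals the sum of the row
    -- degrees `d`.
    let v : Fin (m + 1) → PowerSeries ℚ := Fin.cons 1 fun _ => PowerSeries.X ^ (∑ k, ν k - 1)
    have hdet : (A.det : PowerSeries ℚ) = (∏ k, v k) * B.det := by
      have h1 : (A.det : PowerSeries ℚ) = Polynomial.coeToPowerSeries.ringHom A.det := rfl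
      rw [h1, RingHom.map_det, ← Matrix.det_mul_column]
      refine Matrix.det_eq_of_forall_row_eq_smul_add_const
        (Fin.cons 0 fun j => phiSeries α₀ (α j)) 0 rfl fun k i => ?_
      induction k using Fin.cases with
      | zero =>
        simp only [RingHom.mapMatrix_apply, Matrix.map_apply, Matrix.of_apply, hA0]
        simp [v, B]
      | succ j =>
        simp only [RingHom.mapMatrix_apply, Matrix.map_apply, Matrix.of_apply, hAs]
        have h2 := hR i j
        rw [hsum] at h2
        simp only [v, B, Matrix.of_apply, Fin.cons_succ, Fin.cons_zero, one_mul,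
          coeToPowerSeries.ringHom_apply]
        linear_combination -h2
    have hv : ∏ k, v k = PowerSeries.X ^ (∑ k, d k) := by
      rw [Fin.prod_univ_succ]
      simp only [v, Fin.cons_zero, Fin.cons_succ, one_mul, prod_const, card_univ, Fintype.card_fin,
        ← pow_mul]
      congr 1
      rw [Fin.sum_univ_succ d, hd0, sum_congr rfl fun j _ => hds j, padeDegree, ← sum_add_distrib,
        sum_congr rfl fun j _ => Nat.add_sub_cancel' (hle j)]
      simp [mul_comm]
    rw [hdet, hv]
    exact Dvd.intro _ rfl

theorem exists_padeVec_form_ne_zero (h₀ : 0 < α₀) (hα : ∀ j, 0 < α j)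
    (hdiff : ∀ i j : Fin m, i ≠ j → ∀ k : ℤ, α i - α j ≠ k) {ν : Fin (m + 1) → ℕ}
    (hν : ∀ i, 1 ≤ ν i) (h0 : ∀ j : Fin m, ν j.succ + 1 ≤ ν 0) {z : ℚ} (hz : z ≠ 0)
    {ℓ : Fin (m + 1) → ℤ} (hℓ : ℓ ≠ 0) :
    ∃ i, (ℓ 0 : ℚ) * (padeQ α₀ α (lowerIndex ν i)).eval z +
      ∑ j : Fin m, (ℓ j.succ : ℚ) * (padeP α₀ α (lowerIndex ν i) j).eval z ≠ 0 := by
  by_contra hc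
  push Not at hc
  obtain ⟨c, K, hc0, hdet⟩ := det_padeVec_ne_zero h₀ hα hdiff hν h0
  have h1 := congrArg (Polynomial.evalRingHom z) hdet
  rw [RingHom.map_det] at h1
  have h2 : (Polynomial.evalRingHom z) (C c * X ^ K) ≠ 0 := by simp [hc0, hz]
  rw [← h1] at h2
  refine h2 (Matrix.exists_vecMul_eq_zero_iff.mp ⟨fun k => (ℓ k : ℚ), ?_, ?_⟩)
  · intro h
    exact hℓ (funext fun k => Int.cast_eq_zero.mp (congrFun h k))
  · funext i
    rw [Matrix.vecMul, dotProduct, Fin.sum_univ_succ]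
    exact hc i

end

/-! ### Common denominators of the approximations. -/

theorem norm_le_norm_of_dvd {q : ℕ} [Fact q.Prime] {a b : ℕ} (h : a ∣ b) :
    ‖(b : ℚ_[q])‖ ≤ ‖(a : ℚ_[q])‖ := by
  obtain ⟨c, rfl⟩ := h
  rw [Nat.cast_mul, norm_mul]
  exact mul_le_of_le_one_right (norm_nonneg _) (norm_natCast_le_one c)

/-- A common denominator of the numbers `(y)_k / k!` with `k ≤ n` and `y ≡ x` modulo `1`. -/
def pochDenom (x : ℚ) (n : ℕ) : ℕ := x.den ^ n * factorialPart x.den n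

theorem pochDenom_pos (x : ℚ) (n : ℕ) : 0 < pochDenom x n :=
  Nat.mul_pos (pow_pos x.den_pos _) (factorialPart_pos _ _)

/-- At primes dividing the denominator, `den ^ n` handles `(y)_k` and `factorialPart` handles `k!`;
at all other primes `(y)_k / k!` is already integral. -/
theorem exists_int_pochDenom_mul {x y : ℚ} (hxy : y.den = x.den) {k n : ℕ} (hk : k ≤ n) :
    ∃ z : ℤ, (pochDenom x n : ℚ) * (poch y k / k.factorial) = z := by
  refine exists_int_eq_of_norm_le_one fun q _ => ?_
  have hk0 : 0 < ‖(k.factorial : ℚ_[q])‖ := by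
    rw [norm_pos_iff]; exact_mod_cast k.factorial_ne_zero
  rw [Rat.cast_mul, Rat.cast_div, Rat.cast_natCast, Rat.cast_natCast, norm_mul, norm_div]
  by_cases h : q ∣ y.den
  · have hd0 : 0 < ‖(y.den : ℚ_[q])‖ := by
      rw [norm_pos_iff]; exact_mod_cast y.den_ne_zero
    rw [norm_poch_of_dvd_den h, pochDenom, Nat.cast_mul, norm_mul, ← hxy,
      norm_factorialPart n y.den_ne_zero h, Nat.cast_pow, norm_pow]
    have h1 := norm_factorial_antitone (q := q) hk
    have h2 : ‖(y.den : ℚ_[q])‖ ^ n ≤ ‖(y.den : ℚ_[q])‖ ^ k :=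
      pow_le_pow_of_le_one hd0.le (norm_natCast_le_one _) hk
    rw [inv_pow, ← mul_div_assoc, div_le_one hk0]
    calc _ ≤ ‖(y.den : ℚ_[q])‖ ^ k * ‖(k.factorial : ℚ_[q])‖ * (‖(y.den : ℚ_[q])‖ ^ k)⁻¹ := by gcongr
      _ = ‖(k.factorial : ℚ_[q])‖ := by field_simp
      _ ≤ _ := le_rfl
  · have h1 := norm_poch_le_norm_factorial h k
    exact mul_le_one₀ (norm_natCast_le_one _) (by positivity) (div_le_one_of_le₀ h1 hk0.le)

section

variable {m : ℕ} (α₀ : ℚ) (α : Fin m → ℚ) (ν : Fin (m + 1) → ℕ)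

/-- A common denominator of the coefficients of `padeQ`. -/
def padeDenom : ℕ := pochDenom α₀ (padeDegree ν) * ∏ j : Fin m, pochDenom (α j) (ν j.succ)

theorem padeDenom_pos : 0 < padeDenom α₀ α ν :=
  Nat.mul_pos (pochDenom_pos _ _) (prod_pos fun _ _ => pochDenom_pos _ _)

/-- All arguments of the rising factorials differ from `α₀` or `α_j` by integers, so their reduced
denominators are unchanged. -/
theorem exists_int_padeDenom_mul_padeCoeff {l : ℕ} (hl : l ≤ padeDegree ν) :
    ∃ z : ℤ, (padeDenom α₀ α ν : ℚ) * padeCoeff α₀ α ν l = z := by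
  have h1 : (α₀ + padeDegree ν - l).den = α₀.den := by
    have := Rat.add_intCast_den α₀ (padeDegree ν - l)
    push_cast at this
    rwa [← add_sub_assoc] at this
  obtain ⟨z₁, hz₁⟩ := exists_int_pochDenom_mul h1 hl
  have h2 : ∀ (j : Fin m) (k : ℕ), ∃ z : ℤ, (pochDenom (α j) (ν j.succ) : ℚ) *
      (poch (α j + ν 0 - ν j.succ + k) (ν j.succ) / (ν j.succ).factorial) = z := fun j k => by
    refine exists_int_pochDenom_mul ?_ le_rfl
    have := Rat.add_intCast_den (α j) (ν 0 - ν j.succ + k)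
    push_cast at this
    rwa [← add_assoc, ← add_sub_assoc] at this
  choose z₂ hz₂ using h2
  refine ⟨(-1) ^ l * z₁ * ∑ k ∈ range (l + 1), ((-1) ^ (l - k) * l.choose k : ℤ) * ∏ j, z₂ j k, ?_⟩
  push_cast
  simp only [← hz₂, prod_mul_distrib, ← hz₁, ← eval_nodePoly]
  rw [padeDenom, padeCoeff, newtonCoeff]
  push_cast
  simp only [mul_sum]
  refine sum_congr rfl fun k _ => by ring

theorem exists_int_padeDenom_mul_coeff (k : ℕ) :
    ∃ z : ℤ, (padeDenom α₀ α ν : ℚ) * (padeQ α₀ α ν).coeff k = z := by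
  choose! z hz using fun l (hl : l ≤ padeDegree ν) => exists_int_padeDenom_mul_padeCoeff α₀ α ν hl
  refine ⟨∑ l ∈ range (padeDegree ν + 1), z l * ((X - 1 : ℤ[X]) ^ (padeDegree ν - l)).coeff k, ?_⟩
  rw [padeQ, finsetSum_coeff, mul_sum]
  push_cast
  refine sum_congr rfl fun l hl => ?_
  rw [← hz l (Nat.lt_succ_iff.mp (mem_range.mp hl)), coeff_C_mul, mul_assoc]
  congr 2
  have h : ((X - 1 : ℤ[X]) ^ (padeDegree ν - l)).map (Int.castRingHom ℚ) =
      (X - 1) ^ (padeDegree ν - l) := by simp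
  rw [← h, coeff_map]; rfl

/-- A common denominator of the coefficients of index at most `l` of the series `φ_j`. -/
def phiDenom (l : ℕ) : ℕ :=
  lcmUpTo (maxU α₀ α + maxV α₀ α * l) * dTilde α₀ α ^ l * factorialPart (lcmS α) l

theorem dPart_pos (x : ℚ) : 0 < dPart α₀ x := by
  refine Nat.pos_of_ne_zero fun h => ?_
  have := dPart_mul α₀ x
  rw [h, zero_mul] at this
  exact (Nat.mul_pos α₀.den_pos x.den_pos).ne' this

theorem lcmD_ne_zero : lcmD α₀ α ≠ 0 := by
  rw [lcmD, Ne, Finset.lcm_eq_zero_iff]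
  rintro ⟨j, _, h⟩
  exact (dPart_pos α₀ (α j)).ne' h

theorem lcmS_ne_zero : lcmS α ≠ 0 := by
  rw [lcmS, Ne, Finset.lcm_eq_zero_iff]
  rintro ⟨j, _, h⟩
  exact (α j).den_ne_zero h

theorem dTilde_mul_gcd : dTilde α₀ α * Nat.gcd (lcmD α₀ α) α₀.den = lcmD α₀ α :=
  Nat.div_mul_cancel (Nat.gcd_dvd_left _ _)

theorem dTilde_pos : 0 < dTilde α₀ α := by
  refine Nat.pos_of_ne_zero fun h => lcmD_ne_zero α₀ α ?_
  rw [← dTilde_mul_gcd, h, zero_mul]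

/-- With `g = gcd (d, s₀)`, one has `g s_j ∣ s₀ s_j ∣ d v_j = g d̃ v_j`, and `g` cancels. This is
why `d̃` suffices in place of `d`. -/
theorem den_dvd_dTilde_mul_den (j : Fin m) :
    (α j).den ∣ dTilde α₀ α * (α j + α₀).den := by
  have h1 : α₀.den * (α j).den ∣ lcmD α₀ α * (α j + α₀).den := by
    rw [dPart_mul]
    exact Nat.mul_dvd_mul_right (Finset.dvd_lcm (mem_univ j)) _
  have hg : 0 < Nat.gcd (lcmD α₀ α) α₀.den := Nat.gcd_pos_of_pos_right _ α₀.den_pos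
  obtain ⟨c, hc⟩ := Nat.gcd_dvd_right (lcmD α₀ α) α₀.den
  rw [← dTilde_mul_gcd] at h1
  have h2 : Nat.gcd (lcmD α₀ α) α₀.den * (α j).den ∣
      Nat.gcd (lcmD α₀ α) α₀.den * (dTilde α₀ α * (α j + α₀).den) := by
    refine (Nat.mul_dvd_mul_right (Nat.gcd_dvd_right _ α₀.den) _).trans (h1.trans ?_)
    exact dvd_of_eq (by ring)
  exact Nat.dvd_of_mul_dvd_mul_left hg h2

theorem phiDenom_pos (l : ℕ) : 0 < phiDenom α₀ α l :=
  Nat.mul_pos (Nat.mul_pos (lcmUpTo_pos _) (pow_pos (dTilde_pos _ _) _)) (factorialPart_pos _ _)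

variable {α₀ α}

/-- Four cases. If `q` divides `s_j`, the pole `s_j ^ (-l)` is compensated by `d̃ ^ l`, helped by
`v_j ^ l` when `q ∣ v_j`. If `q` does not divide `v_j`, then `(α_j + α₀)_l` is close to `l!` up to
the factor `lcmUpTo`. That `l!` is matched by `factorialPart` when `q ∣ s_j` and by `(α_j)_l`
otherwise. If `q` divides `v_j` only, the coefficient is already integral. -/
theorem norm_phiDenom_mul_phiCoeff_le_one {q : ℕ} [Fact q.Prime] (h₀ : 0 < α₀) (hα : ∀ j, 0 < α j)
    (j : Fin m) (l : ℕ) :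
    ‖(phiDenom α₀ α l : ℚ_[q])‖ * ‖((phiCoeff α₀ (α j) l : ℚ) : ℚ_[q])‖ ≤ 1 := by
  have hy := add_pos (hα j) h₀
  have hd : ‖(dTilde α₀ α : ℚ_[q])‖ * ‖((α j + α₀).den : ℚ_[q])‖ ≤ ‖((α j).den : ℚ_[q])‖ := by
    rw [← norm_mul]; exact_mod_cast norm_le_norm_of_dvd (den_dvd_dTilde_mul_den α₀ α j)
  have hB : (α j + α₀).num.natAbs + (α j + α₀).den * l ≤ maxU α₀ α + maxV α₀ α * l :=
    Nat.add_le_add (Finset.le_sup (f := fun j => (α j + α₀).num.natAbs) (mem_univ j))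
      (Nat.mul_le_mul_right _ (Finset.le_sup (f := fun j => (α j + α₀).den) (mem_univ j)))
  have hpy : 0 < ‖((poch (α j + α₀) l : ℚ) : ℚ_[q])‖ := by
    rw [norm_pos_iff]; exact_mod_cast (poch_pos hy l).ne'
  have hs0 : 0 < ‖((α j).den : ℚ_[q])‖ := by
    rw [norm_pos_iff]; exact_mod_cast (α j).den_ne_zero
  have hq0 : (0 : ℝ) < q := by exact_mod_cast (Fact.out : q.Prime).pos
  rw [phiCoeff, Rat.cast_div, norm_div, ← mul_div_assoc, div_le_one hpy, phiDenom]
  push_cast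
  rw [norm_mul, norm_mul, norm_pow, norm_lcmUpTo]
  set B := maxU α₀ α + maxV α₀ α * l
  have hqB : (0 : ℝ) < (q : ℝ) ^ Nat.log q B := by positivity
  have hqB1 : ((q : ℝ) ^ Nat.log q B)⁻¹ ≤ 1 :=
    inv_le_one_of_one_le₀ (one_le_pow₀ (by exact_mod_cast (Fact.out : q.Prime).one_lt.le))
  have hfp : ‖(factorialPart (lcmS α) l : ℚ_[q])‖ ≤ 1 := norm_natCast_le_one _
  have hdt : ‖(dTilde α₀ α : ℚ_[q])‖ ≤ 1 := norm_natCast_le_one _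
  have hdtl : ‖(dTilde α₀ α : ℚ_[q])‖ ^ l ≤ 1 := pow_le_one₀ (norm_nonneg _) hdt
  by_cases hs : q ∣ (α j).den
  · rw [norm_poch_of_dvd_den hs, norm_factorialPart l (lcmS_ne_zero α)
      (hs.trans (Finset.dvd_lcm (f := fun j => (α j).den) (mem_univ j))), inv_pow]
    by_cases hv : q ∣ (α j + α₀).den
    · have hv0 : 0 < ‖((α j + α₀).den : ℚ_[q])‖ := by
        rw [norm_pos_iff]; exact_mod_cast (α j + α₀).den_ne_zero
      rw [norm_poch_of_dvd_den hv, inv_pow]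
      have h2 := pow_le_pow_left₀ (by positivity) hd l
      rw [mul_pow] at h2
      have h3 : ‖(l.factorial : ℚ_[q])‖ ≤ 1 := norm_natCast_le_one _
      calc _ ≤ 1 * ‖(dTilde α₀ α : ℚ_[q])‖ ^ l * 1 * (‖((α j).den : ℚ_[q])‖ ^ l)⁻¹ := by gcongr
        _ ≤ _ := by
          rw [one_mul, mul_one, ← div_eq_mul_inv, div_le_iff₀ (by positivity), inv_mul_eq_div,
            le_div_iff₀ (by positivity)]
          exact h2
    · have h1 := norm_factorial_le_norm_poch hy hv hB
      have hv1 : ‖((α j + α₀).den : ℚ_[q])‖ = 1 :=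
        le_antisymm (norm_natCast_le_one _)
          (not_lt.mp fun hc => hv (Padic.norm_natCast_lt_one_iff.mp hc))
      rw [hv1, mul_one] at hd
      calc _ ≤ ((q : ℝ) ^ Nat.log q B)⁻¹ * ‖((α j).den : ℚ_[q])‖ ^ l *
            (‖((poch (α j + α₀) l : ℚ) : ℚ_[q])‖ * (q : ℝ) ^ Nat.log q B) *
            (‖((α j).den : ℚ_[q])‖ ^ l)⁻¹ := by gcongr
        _ = _ := by field_simp
  · by_cases hv : q ∣ (α j + α₀).den
    · have h1 := norm_poch_le_norm_factorial hs l
      have h2 : ‖((poch (α j) l : ℚ) : ℚ_[q])‖ ≤ 1 := h1.trans (norm_natCast_le_one _)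
      calc _ ≤ 1 * 1 * 1 * (1 : ℝ) := by gcongr
        _ ≤ _ := by
          rw [norm_poch_of_dvd_den hv]
          norm_num
          exact one_le_inv_iff₀.mpr ⟨by
            have : 0 < ‖((α j + α₀).den : ℚ_[q])‖ := by
              rw [norm_pos_iff]; exact_mod_cast (α j + α₀).den_ne_zero
            positivity, pow_le_one₀ (norm_nonneg _) (norm_natCast_le_one _)⟩
    · have h1 := norm_factorial_le_norm_poch hy hv hB
      have h2 := norm_poch_le_norm_factorial hs l
      calc _ ≤ ((q : ℝ) ^ Nat.log q B)⁻¹ * 1 * 1 *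
            (‖((poch (α j + α₀) l : ℚ) : ℚ_[q])‖ * (q : ℝ) ^ Nat.log q B) := by
            gcongr; exact h2.trans h1
        _ = _ := by field_simp

theorem lcmUpTo_dvd {x y : ℕ} (h : x ≤ y) : lcmUpTo x ∣ lcmUpTo y := by
  refine (prod_dvd_prod_of_dvd _ _ fun q _ => pow_dvd_pow q (Nat.log_mono_right h)).trans
    (prod_dvd_prod_of_subset _ _ _ (filter_subset_filter _ (range_mono (by omega))))

theorem factorialPart_dvd (s : ℕ) {k l : ℕ} (h : k ≤ l) : factorialPart s k ∣ factorialPart s l := by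
  refine prod_dvd_prod_of_dvd _ _ fun q hq => pow_dvd_pow q ?_
  have : Fact q.Prime := ⟨Nat.prime_of_mem_primeFactors hq⟩
  exact (padicValNat_dvd_iff_le l.factorial_ne_zero).mp
    ((pow_padicValNat_dvd).trans (Nat.factorial_dvd_factorial h))

theorem phiDenom_dvd {k l : ℕ} (h : k ≤ l) : phiDenom α₀ α k ∣ phiDenom α₀ α l :=
  Nat.mul_dvd_mul (Nat.mul_dvd_mul (lcmUpTo_dvd (by gcongr)) (pow_dvd_pow _ h))
    (factorialPart_dvd _ h)

theorem norm_phiDenom_mul_phiCoeff_le_one_of_le {q : ℕ} [Fact q.Prime] (h₀ : 0 < α₀)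
    (hα : ∀ j, 0 < α j) (j : Fin m) {k l : ℕ} (h : k ≤ l) :
    ‖(phiDenom α₀ α l : ℚ_[q])‖ * ‖((phiCoeff α₀ (α j) k : ℚ) : ℚ_[q])‖ ≤ 1 :=
  (mul_le_mul_of_nonneg_right (norm_le_norm_of_dvd (phiDenom_dvd h)) (norm_nonneg _)).trans
    (norm_phiDenom_mul_phiCoeff_le_one h₀ hα j k)

theorem exists_int_phiDenom_mul_phiCoeff (h₀ : 0 < α₀) (hα : ∀ j, 0 < α j) (j : Fin m) {k l : ℕ}
    (h : k ≤ l) : ∃ z : ℤ, (phiDenom α₀ α l : ℚ) * phiCoeff α₀ (α j) k = z := by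
  refine exists_int_eq_of_norm_le_one fun q _ => ?_
  rw [Rat.cast_mul, norm_mul, Rat.cast_natCast]
  exact norm_phiDenom_mul_phiCoeff_le_one_of_le h₀ hα j h

theorem exists_int_mul_coeff_padeP (h₀ : 0 < α₀) (hα : ∀ j, 0 < α j) (j : Fin m) (k : ℕ) :
    ∃ z : ℤ, ((padeDenom α₀ α ν * phiDenom α₀ α (∑ i, ν i) : ℕ) : ℚ) *
      (padeP α₀ α ν j).coeff k = z := by
  rw [padeP, PowerSeries.coeff_trunc]
  split_ifs with hk
  · rw [PowerSeries.coeff_mul]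
    choose z₁ hz₁ using exists_int_padeDenom_mul_coeff α₀ α ν
    choose! z₂ hz₂ using fun l (hl : l ≤ ∑ i, ν i) => exists_int_phiDenom_mul_phiCoeff h₀ hα j hl
    refine ⟨∑ x ∈ antidiagonal k, z₁ x.1 * z₂ x.2, ?_⟩
    rw [mul_sum]
    push_cast
    refine sum_congr rfl fun x hx => ?_
    have hx := mem_antidiagonal.mp hx
    rw [← hz₁, ← hz₂ x.2 (by omega), coeff_phiSeries]
    ring
  · exact ⟨0, by simp⟩

end

/-! ### Archimedean size of the approximations. -/

section Size

variable {m : ℕ} {α₀ : ℚ} {α : Fin m → ℚ} {ν : Fin (m + 1) → ℕ}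

theorem le_num_natAbs {x : ℚ} (hx : 0 < x) : x ≤ x.num.natAbs := by
  have hn : 0 < x.num := Rat.num_pos.mpr hx
  have h1 : ((x.num.natAbs : ℕ) : ℚ) = x.num := by
    have h0 : (x.num.natAbs : ℤ) = x.num := by omega
    exact congrArg (fun z : ℤ => (z : ℚ)) h0
  rw [h1]
  nth_rw 1 [← Rat.num_div_den x]
  refine div_le_self (by exact_mod_cast hn.le) ?_
  exact_mod_cast x.den_pos

theorem num_natAbs_pos {x : ℚ} (hx : 0 < x) : 0 < x.num.natAbs := by
  have hn : 0 < x.num := Rat.num_pos.mpr hx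
  omega

theorem poch_div_factorial_le_choose {x : ℚ} (hx : 0 ≤ x) {k : ℕ} (h : x ≤ k + 1) (n : ℕ) :
    poch x n / n.factorial ≤ (k + n).choose n := by
  have hn : (0 : ℚ) < n.factorial := by positivity
  rw [div_le_iff₀ hn, mul_comm]
  exact (poch_mono hx h n).trans_eq (poch_natCast_succ k n)

theorem poch_nonneg {x : ℚ} (hx : 0 ≤ x) (n : ℕ) : 0 ≤ poch x n :=
  prod_nonneg fun i _ => by positivity

/-- Replacing `α_j` by the integer `r_j ≥ α_j` bounds each factor by a binomial coefficient, hence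
by a power of two. -/
theorem abs_eval_nodePoly_le (hα : ∀ j, 0 < α j) (hν : ∀ j : Fin m, ν j.succ ≤ ν 0) {k : ℕ}
    (hk : k ≤ padeDegree ν) :
    |(nodePoly α ν).eval (k : ℚ)| ≤ 2 ^ (m * (maxR α + ∑ i, ν i)) := by
  rw [eval_nodePoly, abs_prod, mul_comm, pow_mul]
  refine (prod_le_prod (g := fun _ => (2 : ℚ) ^ (maxR α + ∑ i, ν i)) (fun _ _ => abs_nonneg _)
    fun j _ => ?_).trans_eq (by simp)
  have h1 : (ν j.succ : ℚ) ≤ ν 0 := by exact_mod_cast hν j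
  have h2 := le_num_natAbs (hα j)
  have h3 := num_natAbs_pos (hα j)
  have h4 := hα j
  have h5 : (α j).num.natAbs ≤ maxR α :=
    Finset.le_sup (f := fun j => (α j).num.natAbs) (mem_univ j)
  have hx : (0 : ℚ) ≤ α j + ν 0 - ν j.succ + k := by
    have : (0 : ℚ) ≤ k := by positivity
    linarith
  rw [abs_of_nonneg (div_nonneg (poch_nonneg hx _) (by positivity))]
  have h6 := poch_div_factorial_le_choose hx
    (k := (α j).num.natAbs - 1 + (ν 0 - ν j.succ) + k) (by
      push_cast [Nat.cast_sub h3, Nat.cast_sub (hν j)]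
      linarith) (ν j.succ)
  refine h6.trans ?_
  have h7 := sum_eq_padeDegree_add ν
  have h8 := hν j
  have h9 : ((α j).num.natAbs - 1 + (ν 0 - ν j.succ) + k + ν j.succ).choose (ν j.succ) ≤
      2 ^ (maxR α + ∑ i, ν i) :=
    (Nat.choose_le_two_pow _ _).trans (Nat.pow_le_pow_right (by norm_num) (by omega))
  exact_mod_cast h9

theorem abs_newtonCoeff_le {P : ℚ[X]} {B : ℚ} {l : ℕ} (h : ∀ k ≤ l, |P.eval (k : ℚ)| ≤ B) :
    |newtonCoeff P l| ≤ 2 ^ l * B := by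
  refine (abs_sum_le_sum_abs _ _).trans ?_
  have h1 : ∑ k ∈ range (l + 1), |(((-1) ^ (l - k) * l.choose k : ℤ) : ℚ) * P.eval (k : ℚ)| ≤
      ∑ k ∈ range (l + 1), (l.choose k : ℚ) * B := by
    refine sum_le_sum fun k hk => ?_
    push_cast
    rw [abs_mul, abs_mul, abs_pow, abs_neg, abs_one, one_pow, one_mul, Nat.abs_cast]
    exact mul_le_mul_of_nonneg_left (h k (Nat.lt_succ_iff.mp (mem_range.mp hk))) (by positivity)
  refine h1.trans_eq ?_
  rw [← sum_mul]
  congr 1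
  exact_mod_cast Nat.sum_range_choose l

/-- The weight `2 ^ (N - l)` is the sum of the absolute coefficients of `(X - 1) ^ (N - l)`. With
the factor `2 ^ l` from the Newton coefficient it gives `2 ^ N`, and the remaining binomial
coefficients sum to at most `2 ^ (r + N)`. -/
theorem sum_abs_padeCoeff_le (h₀ : 0 < α₀) (hα : ∀ j, 0 < α j)
    (hν : ∀ j : Fin m, ν j.succ ≤ ν 0) :
    ∑ l ∈ range (padeDegree ν + 1), |padeCoeff α₀ α ν l| * 2 ^ (padeDegree ν - l) ≤
      2 ^ (2 * padeDegree ν + α₀.num.natAbs + m * (maxR α + ∑ i, ν i)) := by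
  set N := padeDegree ν
  set r := α₀.num.natAbs
  have hr : 0 < r := num_natAbs_pos h₀
  have key : ∀ l ∈ range (N + 1), |padeCoeff α₀ α ν l| * 2 ^ (N - l) ≤
      2 ^ N * 2 ^ (m * (maxR α + ∑ i, ν i)) * ((r - 1 + N).choose l : ℚ) := by
    intro l hl
    have hl : l ≤ N := Nat.lt_succ_iff.mp (mem_range.mp hl)
    have hlq : (l : ℚ) ≤ N := by exact_mod_cast hl
    have h1 := le_num_natAbs h₀
    have hx : (0 : ℚ) ≤ α₀ + N - l := by linarith
    have h2 := poch_div_factorial_le_choose hx (k := r - 1 + (N - l)) (by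
      push_cast [Nat.cast_sub hr, Nat.cast_sub hl]
      linarith) l
    rw [show r - 1 + (N - l) + l = r - 1 + N by omega] at h2
    have h3 := abs_newtonCoeff_le (P := nodePoly α ν) (l := l)
      fun k hk => abs_eval_nodePoly_le hα hν (hk.trans hl)
    have h4 : (0 : ℚ) ≤ poch (α₀ + N - l) l / l.factorial :=
      div_nonneg (poch_nonneg hx _) (by positivity)
    rw [padeCoeff, abs_mul, abs_mul, abs_pow, abs_neg, abs_one, one_pow, one_mul,
      abs_of_nonneg h4]
    calc _ ≤ ((r - 1 + N).choose l : ℚ) * (2 ^ l * 2 ^ (m * (maxR α + ∑ i, ν i))) * 2 ^ (N - l) := by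
          gcongr
      _ = (2 ^ l * 2 ^ (N - l)) * 2 ^ (m * (maxR α + ∑ i, ν i)) * ((r - 1 + N).choose l : ℚ) := by
          ring
      _ = _ := by rw [← pow_add, Nat.add_sub_cancel' hl]
  refine (sum_le_sum key).trans ?_
  rw [← mul_sum]
  have h5 : ∑ l ∈ range (N + 1), (r - 1 + N).choose l ≤ 2 ^ (r + N) := by
    refine (sum_le_sum_of_subset (range_mono (by omega : N + 1 ≤ r - 1 + N + 1))).trans ?_
    rw [Nat.sum_range_choose]
    exact Nat.pow_le_pow_right (by norm_num) (by omega)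
  have h6 : ∑ l ∈ range (N + 1), ((r - 1 + N).choose l : ℚ) ≤ 2 ^ (r + N) := by exact_mod_cast h5
  calc _ ≤ (2 : ℚ) ^ N * 2 ^ (m * (maxR α + ∑ i, ν i)) * 2 ^ (r + N) := by gcongr
    _ = _ := by ring

/-- The bound for the coefficients of the Padé approximations of index `ν`. -/
def padeBound (α₀ : ℚ) (α : Fin m → ℚ) (ν : Fin (m + 1) → ℕ) : ℚ :=
  2 ^ (2 * padeDegree ν + α₀.num.natAbs + m * (maxR α + ∑ i, ν i))

theorem abs_eval_padeQ_le (h₀ : 0 < α₀) (hα : ∀ j, 0 < α j) (hν : ∀ j : Fin m, ν j.succ ≤ ν 0)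
    {z : ℚ} (hz : 1 ≤ |z|) :
    |(padeQ α₀ α ν).eval z| ≤ padeBound α₀ α ν * |z| ^ padeDegree ν := by
  refine le_trans ?_ (mul_le_mul_of_nonneg_right (sum_abs_padeCoeff_le h₀ hα hν) (by positivity))
  rw [padeQ, eval_finsetSum, sum_mul]
  refine (abs_sum_le_sum_abs _ _).trans (sum_le_sum fun l hl => ?_)
  have hl : l ≤ padeDegree ν := Nat.lt_succ_iff.mp (mem_range.mp hl)
  have h1 : |z - 1| ≤ 2 * |z| := by
    have := abs_sub z 1
    rw [abs_one] at this
    linarith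
  simp only [eval_mul, eval_C, eval_pow, eval_sub, eval_X, eval_one]
  rw [abs_mul, abs_pow]
  calc _ ≤ |padeCoeff α₀ α ν l| * (2 * |z|) ^ (padeDegree ν - l) := by gcongr
    _ = |padeCoeff α₀ α ν l| * 2 ^ (padeDegree ν - l) * |z| ^ (padeDegree ν - l) := by
      rw [mul_pow]; ring
    _ ≤ _ := by gcongr; omega

/-- The coefficients of `φ_j` lie in `[0, 1]`, so multiplying by `φ_j` costs nothing beyond the
weights already counted for `Q`. -/
theorem abs_coeff_padeQ_mul_phiSeries_le (h₀ : 0 < α₀) (hα : ∀ j, 0 < α j)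
    (hν : ∀ j : Fin m, ν j.succ ≤ ν 0) (j : Fin m) (k : ℕ) :
    |PowerSeries.coeff k ((padeQ α₀ α ν : PowerSeries ℚ) * phiSeries α₀ (α j))| ≤
      padeBound α₀ α ν := by
  refine le_trans ?_ (sum_abs_padeCoeff_le h₀ hα hν)
  rw [coe_padeQ_mul, map_sum]
  refine (abs_sum_le_sum_abs _ _).trans (sum_le_sum fun l _ => ?_)
  rw [PowerSeries.coeff_C_mul, abs_mul]
  refine mul_le_mul_of_nonneg_left (abs_coeff_X_sub_one_pow_mul_le (fun i => ?_) _ _) (abs_nonneg _)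
  rw [coeff_phiSeries]
  exact abs_phiCoeff_le_one h₀ (hα j) i

theorem abs_eval_padeP_le (h₀ : 0 < α₀) (hα : ∀ j, 0 < α j) (hν : ∀ j : Fin m, ν j.succ ≤ ν 0)
    {z : ℚ} (hz : 1 ≤ |z|) (j : Fin m) :
    |(padeP α₀ α ν j).eval z| ≤
      (∑ i, ν i : ℕ) * padeBound α₀ α ν * |z| ^ (∑ i, ν i - ν j.succ - 1) := by
  have hB : 0 ≤ padeBound α₀ α ν := by unfold padeBound; positivity
  set K := ∑ i, ν i - ν j.succ with hK
  have h1 : (padeP α₀ α ν j).eval z =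
      ∑ k ∈ range K, PowerSeries.coeff k ((padeQ α₀ α ν : PowerSeries ℚ) * phiSeries α₀ (α j)) *
        z ^ k := by
    rw [padeP, ← hK]
    exact PowerSeries.eval₂_trunc_eq_sum_range z (RingHom.id ℚ) K _
  rw [h1]
  refine (abs_sum_le_sum_abs _ _).trans ?_
  refine (sum_le_card_nsmul _ _ (padeBound α₀ α ν * |z| ^ (K - 1)) fun k hk => ?_).trans ?_
  · rw [abs_mul, abs_pow]
    have := mem_range.mp hk
    exact mul_le_mul (abs_coeff_padeQ_mul_phiSeries_le h₀ hα hν j k)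
      (pow_le_pow_right₀ hz (by omega)) (by positivity) hB
  · rw [card_range, nsmul_eq_mul, mul_assoc]
    have : (K : ℚ) ≤ (∑ i, ν i : ℕ) := by exact_mod_cast Nat.sub_le _ _
    gcongr

end Size

/-! ### Convergence and the `p`-adic remainder. -/

section Padic

variable {p : ℕ} [Fact p.Prime] {m : ℕ} {α₀ : ℚ} {α : Fin m → ℚ}

theorem hasSum_X_mul {f : PowerSeries ℚ} {z : ℚ} {v : ℚ_[p]}
    (hf : HasSum (fun k => ((PowerSeries.coeff k f : ℚ) : ℚ_[p]) * (z : ℚ_[p]) ^ k) v) :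
    HasSum (fun k => ((PowerSeries.coeff k (PowerSeries.X * f) : ℚ) : ℚ_[p]) * (z : ℚ_[p]) ^ k)
      (z * v) := by
  rw [← hasSum_nat_add_iff' 1]
  simp only [PowerSeries.coeff_succ_X_mul, range_one, sum_singleton, PowerSeries.coeff_zero_X_mul,
    Rat.cast_zero, zero_mul, sub_zero]
  refine (hf.mul_left (z : ℚ_[p])).congr_fun fun k => ?_
  ring

theorem hasSum_coe_mul {f : PowerSeries ℚ} {z : ℚ} {v : ℚ_[p]}
    (hf : HasSum (fun k => ((PowerSeries.coeff k f : ℚ) : ℚ_[p]) * (z : ℚ_[p]) ^ k) v) (P : ℚ[X]) :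
    HasSum (fun k => ((PowerSeries.coeff k ((P : PowerSeries ℚ) * f) : ℚ) : ℚ_[p]) *
      (z : ℚ_[p]) ^ k) ((P.eval z : ℚ) * v) := by
  induction P using Polynomial.induction_on' with
  | add P Q hP hQ =>
    rw [eval_add, Rat.cast_add, add_mul]
    refine (hP.add hQ).congr_fun fun k => ?_
    rw [Polynomial.coe_add, add_mul, map_add]
    push_cast; ring
  | monomial n a =>
    induction n with
    | zero =>
      rw [eval_monomial, pow_zero, mul_one]
      refine (hf.mul_left (a : ℚ_[p])).congr_fun fun k => ?_
      rw [monomial_zero_left, Polynomial.coe_C, PowerSeries.coeff_C_mul]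
      push_cast; ring
    | succ n ih =>
      have h := hasSum_X_mul ih
      rw [eval_monomial] at h ⊢
      rw [pow_succ]
      convert! h using 1
      · funext k
        rw [← mul_assoc, ← Polynomial.coe_X, ← Polynomial.coe_mul, X_mul_monomial]
      · push_cast; ring

theorem inv_natCast_le_norm {n : ℕ} (hn : n ≠ 0) : (n : ℝ)⁻¹ ≤ ‖(n : ℚ_[p])‖ := by
  rw [norm_natCast_eq_inv_pow_padicValNat hn]
  have h1 : p ^ padicValNat p n ≤ n := Nat.le_of_dvd (Nat.pos_of_ne_zero hn) pow_padicValNat_dvd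
  have h2 : 0 < (p : ℝ) := by exact_mod_cast (Fact.out : p.Prime).pos
  gcongr
  exact_mod_cast h1

theorem inv_norm_factorial_le (t : ℕ) : ‖(t.factorial : ℚ_[p])‖⁻¹ ≤ 2 ^ t := by
  rw [norm_natCast_eq_inv_pow_padicValNat t.factorial_ne_zero, inv_inv]
  have hp := (Fact.out : p.Prime)
  have h := sub_one_mul_padicValNat_factorial (p := p) t
  have h1 : p ≤ 2 ^ (p - 1) := by
    have := Nat.lt_two_pow_self (n := p - 1)
    have := hp.two_le
    omega
  have h2 : p ^ padicValNat p t.factorial ≤ 2 ^ t :=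
    calc _ ≤ (2 ^ (p - 1)) ^ padicValNat p t.factorial := Nat.pow_le_pow_left h1 _
      _ ≤ 2 ^ t := by
        rw [← pow_mul]
        exact Nat.pow_le_pow_right (by norm_num) (by omega)
  exact_mod_cast h2

/-- Write `(M + t)!` as `C(M + t, M) M! t!`: the power of `p` in the binomial coefficient is at most
`M + t`, and the one in `t!` is at most `2 ^ t`. -/
theorem norm_factorialPart_le (s M t : ℕ) (hs : s ≠ 0) (hM : 0 < M) :
    ‖(factorialPart s M : ℚ_[p])‖ ≤
      2 ^ t * ((M + t : ℕ) : ℝ) * ‖(factorialPart s (M + t) : ℚ_[p])‖ := by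
  have h1 : (1 : ℝ) ≤ 2 ^ t := one_le_pow₀ (by norm_num)
  have h2 : (1 : ℝ) ≤ ((M + t : ℕ) : ℝ) := by exact_mod_cast (by omega : 1 ≤ M + t)
  by_cases h : p ∣ s
  · rw [norm_factorialPart _ hs h, norm_factorialPart _ hs h]
    have h3 : ((M + t).factorial : ℚ_[p]) = (M + t).choose M * M.factorial * t.factorial := by
      rw [Nat.choose_symm_add]
      exact_mod_cast (Nat.add_choose_mul_factorial_mul_factorial M t).symm
    rw [h3, norm_mul, norm_mul]
    have hc0 : (M + t).choose M ≠ 0 := (Nat.choose_pos (by omega)).ne'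
    have h4 : (((M + t : ℕ) : ℝ))⁻¹ ≤ ‖((M + t).choose M : ℚ_[p])‖ := by
      rw [norm_natCast_eq_inv_pow_padicValNat hc0]
      have h5 := Nat.pow_factorization_choose_le (p := p) (n := M + t) (k := M) (by omega)
      rw [Nat.factorization_def _ Fact.out] at h5
      have h6 : 0 < (p : ℝ) := by exact_mod_cast (Fact.out : p.Prime).pos
      gcongr
      exact_mod_cast h5
    have h7 := inv_norm_factorial_le (p := p) t
    have h8 : 0 < ‖(t.factorial : ℚ_[p])‖ := by
      rw [norm_pos_iff]; exact_mod_cast t.factorial_ne_zero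
    have h9 : 1 ≤ 2 ^ t * ‖(t.factorial : ℚ_[p])‖ := by
      rwa [inv_le_iff_one_le_mul₀ h8] at h7
    have h10 : 1 ≤ ((M + t : ℕ) : ℝ) * ‖((M + t).choose M : ℚ_[p])‖ := by
      rwa [inv_le_iff_one_le_mul₀ (by linarith), mul_comm] at h4
    have h11 := one_le_mul_of_one_le_of_one_le h9 h10
    calc _ = 1 * ‖(M.factorial : ℚ_[p])‖ := (one_mul _).symm
      _ ≤ 2 ^ t * ‖(t.factorial : ℚ_[p])‖ * (((M + t : ℕ) : ℝ) * ‖((M + t).choose M : ℚ_[p])‖) *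
          ‖(M.factorial : ℚ_[p])‖ := by gcongr
      _ = _ := by ring
  · rw [norm_factorialPart_of_not_dvd _ h, norm_factorialPart_of_not_dvd _ h]
    nlinarith

theorem norm_phiDenom_le (M t : ℕ) (hM : 0 < M) (hV : 0 < maxV α₀ α) :
    ‖(phiDenom α₀ α M : ℚ_[p])‖ ≤ (maxU α₀ α + maxV α₀ α * (M + t)) * (M + t) *
      (2 * dTilde α₀ α) ^ t * ‖(phiDenom α₀ α (M + t) : ℚ_[p])‖ := by
  have h1 := norm_factorialPart_le (p := p) (lcmS α) M t (lcmS_ne_zero α) hM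
  have h2 : ‖(lcmUpTo (maxU α₀ α + maxV α₀ α * M) : ℚ_[p])‖ ≤
      (maxU α₀ α + maxV α₀ α * (M + t)) *
        ‖(lcmUpTo (maxU α₀ α + maxV α₀ α * (M + t)) : ℚ_[p])‖ := by
    refine (norm_natCast_le_one _).trans ?_
    rw [norm_lcmUpTo]
    have h0 : maxU α₀ α + maxV α₀ α * (M + t) ≠ 0 := by positivity
    have h3 := Nat.pow_log_le_self p h0
    have h4 : 0 < (p : ℝ) := by exact_mod_cast (Fact.out : p.Prime).pos
    rw [← div_eq_mul_inv, le_div_iff₀ (by positivity), one_mul]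
    exact_mod_cast h3
  have h3 : (1 : ℝ) ≤ dTilde α₀ α ^ t * ‖(dTilde α₀ α : ℚ_[p])‖ ^ t := by
    rw [← mul_pow]
    refine one_le_pow₀ ?_
    have h4 := inv_natCast_le_norm (p := p) (dTilde_pos α₀ α).ne'
    have h5 : (0 : ℝ) < dTilde α₀ α := by exact_mod_cast dTilde_pos α₀ α
    rwa [inv_le_iff_one_le_mul₀ h5, mul_comm] at h4
  unfold phiDenom
  push_cast
  rw [norm_mul, norm_mul, norm_mul, norm_mul, norm_pow, norm_pow, pow_add]
  push_cast at h1
  calc _ ≤ ((maxU α₀ α + maxV α₀ α * (M + t)) *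
        ‖(lcmUpTo (maxU α₀ α + maxV α₀ α * (M + t)) : ℚ_[p])‖) *
        (‖(dTilde α₀ α : ℚ_[p])‖ ^ M * (dTilde α₀ α ^ t * ‖(dTilde α₀ α : ℚ_[p])‖ ^ t)) *
        (2 ^ t * (M + t) * ‖(factorialPart (lcmS α) (M + t) : ℚ_[p])‖) := by
        gcongr
        exact le_mul_of_one_le_right (by positivity) h3
    _ = _ := by rw [mul_pow]; ring

theorem one_add_le_two_pow (t : ℕ) : (1 + t : ℝ) ≤ 2 ^ t := by
  exact_mod_cast (by have := Nat.lt_two_pow_self (n := t); omega : 1 + t ≤ 2 ^ t)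

/-- The denominator for index `M` must also serve coefficients of index `M + t`. The loss is
geometric: two polynomial factors grow by at most `2 ^ t` each, and `(2 d̃) ^ t` comes from
`norm_phiDenom_le`. The surplus `y ^ t` pays for it because `8 d̃ y ≤ 1`. -/
theorem norm_phiDenom_mul_phiCoeff_mul_pow_le (h₀ : 0 < α₀) (hα : ∀ j, 0 < α j) (j : Fin m)
    {y : ℝ} (hy : 0 ≤ y) (hy1 : 8 * dTilde α₀ α * y ≤ 1) {M k l : ℕ} (hM : 0 < M) (hMk : M ≤ k)
    (hlk : l ≤ k) :
    ‖(phiDenom α₀ α M : ℚ_[p])‖ * ‖((phiCoeff α₀ (α j) l : ℚ) : ℚ_[p])‖ * y ^ k ≤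
      y ^ M * (M * (maxU α₀ α + maxV α₀ α * M)) := by
  have hd : (1 : ℝ) ≤ dTilde α₀ α := by exact_mod_cast dTilde_pos α₀ α
  have hyle : y ≤ 1 := by nlinarith
  have hV : 0 < maxV α₀ α := (α j + α₀).den_pos.trans_le
    (Finset.le_sup (f := fun j => (α j + α₀).den) (mem_univ j))
  have hM1 : (1 : ℝ) ≤ M := by exact_mod_cast hM
  have hV1 : (1 : ℝ) ≤ maxV α₀ α := by exact_mod_cast hV
  have hU0 : (0 : ℝ) ≤ maxU α₀ α := by positivity
  have hfac : (1 : ℝ) ≤ M * (maxU α₀ α + maxV α₀ α * M) :=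
    one_le_mul_of_one_le_of_one_le hM1 (by nlinarith)
  rcases le_total l M with hl | hl
  · have h1 := norm_phiDenom_mul_phiCoeff_le_one_of_le (q := p) h₀ hα j hl
    calc _ ≤ 1 * y ^ M := by
          gcongr 1
          exact pow_le_pow_of_le_one hy hyle hMk
      _ ≤ _ := by rw [one_mul]; exact le_mul_of_one_le_right (by positivity) hfac
  · obtain ⟨t, rfl⟩ := Nat.exists_eq_add_of_le hl
    have h1 := norm_phiDenom_mul_phiCoeff_le_one (q := p) h₀ hα j (M + t)
    have h2 := norm_phiDenom_le (p := p) (α₀ := α₀) (α := α) M t hM hV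
    have h3 := one_add_le_two_pow t
    have ht : (0 : ℝ) ≤ t := by positivity
    have h4 : (maxU α₀ α + maxV α₀ α * (M + t) : ℝ) ≤
        (maxU α₀ α + maxV α₀ α * M) * 2 ^ t := by
      calc _ ≤ (maxU α₀ α + maxV α₀ α * M) * (1 + t : ℝ) := by
            nlinarith [mul_nonneg ht hU0, mul_nonneg ht (mul_nonneg (zero_le_one.trans hV1)
              (sub_nonneg.mpr hM1))]
        _ ≤ _ := by gcongr
    have h5 : (M + t : ℝ) ≤ M * 2 ^ t := by
      calc (M + t : ℝ) ≤ M * (1 + t) := by nlinarith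
        _ ≤ _ := by gcongr
    have h6 : y ^ k ≤ y ^ M * y ^ t := by
      rw [← pow_add]; exact pow_le_pow_of_le_one hy hyle hlk
    calc _ ≤ ((maxU α₀ α + maxV α₀ α * (M + t)) * (M + t) *
          (2 * dTilde α₀ α) ^ t * ‖(phiDenom α₀ α (M + t) : ℚ_[p])‖) *
          ‖((phiCoeff α₀ (α j) (M + t) : ℚ) : ℚ_[p])‖ * (y ^ M * y ^ t) := by gcongr
      _ = (maxU α₀ α + maxV α₀ α * (M + t)) * (M + t) *
          (2 * dTilde α₀ α) ^ t * (y ^ M * y ^ t) * (‖(phiDenom α₀ α (M + t) : ℚ_[p])‖ *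
          ‖((phiCoeff α₀ (α j) (M + t) : ℚ) : ℚ_[p])‖) := by ring
      _ ≤ ((maxU α₀ α + maxV α₀ α * M) * 2 ^ t) * (M * 2 ^ t) *
          (2 * dTilde α₀ α) ^ t * (y ^ M * y ^ t) * 1 := by gcongr
      _ = y ^ M * (M * (maxU α₀ α + maxV α₀ α * M)) * (8 * dTilde α₀ α * y) ^ t := by
        have h7 : (8 * dTilde α₀ α * y : ℝ) ^ t = 2 ^ t * 2 ^ t * (2 * dTilde α₀ α) ^ t * y ^ t := by
          rw [← mul_pow, ← mul_pow, ← mul_pow]; congr 1; ring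
        rw [h7]
        ring
      _ ≤ y ^ M * (M * (maxU α₀ α + maxV α₀ α * M)) * 1 := by
        gcongr
        exact pow_le_one₀ (by positivity) hy1
      _ = _ := mul_one _

/-- Same growth estimate with base index `1`; `16` instead of `8` leaves a ratio `1 / 2` for a
geometric majorant. -/
theorem summable_phiCoeff_mul_pow (h₀ : 0 < α₀) (hα : ∀ j, 0 < α j) (j : Fin m) {z : ℚ_[p]}
    (hz : 16 * dTilde α₀ α * ‖z‖ ≤ 1) :
    Summable fun l => ((phiCoeff α₀ (α j) l : ℚ) : ℚ_[p]) * z ^ l := by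
  have hd : (1 : ℝ) ≤ dTilde α₀ α := by exact_mod_cast dTilde_pos α₀ α
  have hV : 0 < maxV α₀ α := (α j + α₀).den_pos.trans_le
    (Finset.le_sup (f := fun j => (α j + α₀).den) (mem_univ j))
  have hV1 : (1 : ℝ) ≤ maxV α₀ α := by exact_mod_cast hV
  have hU0 : (0 : ℝ) ≤ maxU α₀ α := by positivity
  have h10 : 0 < ‖(phiDenom α₀ α 1 : ℚ_[p])‖ := by
    rw [norm_pos_iff]; exact_mod_cast (phiDenom_pos α₀ α 1).ne'
  set C : ℝ := (maxU α₀ α + maxV α₀ α) / ‖(phiDenom α₀ α 1 : ℚ_[p])‖ with hC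
  refine (summable_nat_add_iff 1).mp (Summable.of_norm_bounded
    (g := fun t : ℕ => C * ((1 / 2 : ℝ) ^ t)) ?_ fun t => ?_)
  · exact (summable_geometric_of_lt_one (by norm_num) (by norm_num)).mul_left C
  · rw [norm_mul, norm_pow, add_comm t 1]
    have h1 := norm_phiDenom_mul_phiCoeff_le_one (q := p) h₀ hα j (1 + t)
    have h2 := norm_phiDenom_le (p := p) (α₀ := α₀) (α := α) 1 t one_pos hV
    have h3 := one_add_le_two_pow t
    have ht : (0 : ℝ) ≤ t := by positivity
    have hz0 := norm_nonneg z
    have hz1 : ‖z‖ ≤ 1 := by nlinarith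
    push_cast at h2
    have h4 : (maxU α₀ α + maxV α₀ α * (1 + t) : ℝ) ≤ (maxU α₀ α + maxV α₀ α) * 2 ^ t := by
      calc _ ≤ (maxU α₀ α + maxV α₀ α) * (1 + t : ℝ) := by nlinarith [mul_nonneg ht hU0]
        _ ≤ _ := by gcongr
    rw [hC, div_mul_eq_mul_div, le_div_iff₀ h10]
    have h5 : (8 * dTilde α₀ α * ‖z‖) ^ t = 2 ^ t * 2 ^ t * (2 * dTilde α₀ α) ^ t * ‖z‖ ^ t := by
      rw [← mul_pow, ← mul_pow, ← mul_pow]; congr 1; ring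
    have h6 : (8 * dTilde α₀ α * ‖z‖) ^ t ≤ (1 / 2) ^ t :=
      pow_le_pow_left₀ (by positivity) (by linarith) t
    calc _ ≤ ‖((phiCoeff α₀ (α j) (1 + t) : ℚ) : ℚ_[p])‖ * ‖z‖ ^ (1 + t) *
          ((maxU α₀ α + maxV α₀ α * (1 + t)) * (1 + t) * (2 * dTilde α₀ α) ^ t *
          ‖(phiDenom α₀ α (1 + t) : ℚ_[p])‖) := by gcongr
      _ = ‖z‖ * ‖z‖ ^ t *
          ((maxU α₀ α + maxV α₀ α * (1 + t)) * (1 + t) * (2 * dTilde α₀ α) ^ t) *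
          (‖(phiDenom α₀ α (1 + t) : ℚ_[p])‖ * ‖((phiCoeff α₀ (α j) (1 + t) : ℚ) : ℚ_[p])‖) := by
        ring
      _ ≤ 1 * ‖z‖ ^ t * (((maxU α₀ α + maxV α₀ α) * 2 ^ t) * 2 ^ t * (2 * dTilde α₀ α) ^ t) * 1 := by
        gcongr
      _ = (maxU α₀ α + maxV α₀ α) * (8 * dTilde α₀ α * ‖z‖) ^ t := by rw [h5]; ring
      _ ≤ _ := by gcongr

end Padic

/-! ### The lower bound obtained from one approximation. -/

theorem exists_int_mul_pow_mul_eval {D : ℚ} {P : ℚ[X]} {M : ℕ} (hP : ∀ k, ∃ z : ℤ, D * P.coeff k = z)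
    (hM : P.natDegree ≤ M) (a : ℤ) {b : ℤ} (hb : b ≠ 0) :
    ∃ z : ℤ, D * b ^ M * P.eval ((a : ℚ) / b) = z := by
  choose z hz using hP
  refine ⟨∑ i ∈ range (M + 1), z i * (a ^ i * b ^ (M - i)), ?_⟩
  rw [eval_eq_sum_range' (Nat.lt_succ_iff.mpr hM), mul_sum]
  push_cast
  refine sum_congr rfl fun i hi => ?_
  have hi : i ≤ M := Nat.lt_succ_iff.mp (mem_range.mp hi)
  have hb' : (b : ℚ) ≠ 0 := by exact_mod_cast hb
  rw [← hz, div_pow]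
  nth_rw 1 [← Nat.add_sub_cancel' hi]
  rw [pow_add]
  field_simp

section

variable {p : ℕ} [Fact p.Prime] {m : ℕ} {α₀ : ℚ} {α : Fin m → ℚ} {ν : Fin (m + 1) → ℕ}

theorem phiTerm_eq (α₀ x : ℚ) (z : ℚ_[p]) (l : ℕ) :
    phiTerm p α₀ x z l = ((phiCoeff α₀ x l : ℚ) : ℚ_[p]) * z ^ l := by
  rw [phiTerm, ascPochhammer_eval_eq_poch, ascPochhammer_eval_eq_poch, phiCoeff]

theorem summable_phiTerm (h₀ : 0 < α₀) (hα : ∀ j, 0 < α j) (j : Fin m) {z : ℚ_[p]}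
    (hz : 16 * dTilde α₀ α * ‖z‖ ≤ 1) : Summable (phiTerm p α₀ (α j) z) :=
  (summable_phiCoeff_mul_pow h₀ hα j hz).congr fun l => (phiTerm_eq α₀ (α j) z l).symm

theorem norm_remainder_le (h₀ : 0 < α₀) (hα : ∀ j, 0 < α j) (hν : ∀ j : Fin m, ν j.succ ≤ ν 0)
    (hM : 0 < ∑ i, ν i) {z : ℚ} (hz : 16 * dTilde α₀ α * ‖(z : ℚ_[p])‖ ≤ 1) (j : Fin m) :
    ‖((padeDenom α₀ α ν * phiDenom α₀ α (∑ i, ν i) : ℕ) : ℚ_[p]) *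
      (((padeQ α₀ α ν).eval z : ℚ) * phi p α₀ (α j) z - ((padeP α₀ α ν j).eval z : ℚ))‖ ≤
      ‖(z : ℚ_[p])‖ ^ (∑ i, ν i) *
        ((∑ i, ν i : ℕ) * (maxU α₀ α + maxV α₀ α * (∑ i, ν i : ℕ))) := by
  set M := ∑ i, ν i with hMdef
  have hsum := (summable_phiTerm h₀ hα j hz).hasSum
  have hφ : HasSum (fun k => ((PowerSeries.coeff k (phiSeries α₀ (α j)) : ℚ) : ℚ_[p]) *
      (z : ℚ_[p]) ^ k) (phi p α₀ (α j) z) := by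
    refine hsum.congr_fun fun k => ?_
    rw [phiTerm_eq, coeff_phiSeries]
  have hone : HasSum (fun k => ((PowerSeries.coeff k (1 : PowerSeries ℚ) : ℚ) : ℚ_[p]) *
      (z : ℚ_[p]) ^ k) 1 := by
    convert! hasSum_ite_eq (0 : ℕ) (1 : ℚ_[p]) using 1
    funext k
    rw [PowerSeries.coeff_one]
    split_ifs with h
    · simp [h]
    · simp
  have h1 := (hasSum_coe_mul hφ (padeQ α₀ α ν)).sub (hasSum_coe_mul hone (padeP α₀ α ν j))
  simp only [mul_one] at h1
  have h2 := h1.mul_left ((padeDenom α₀ α ν * phiDenom α₀ α M : ℕ) : ℚ_[p])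
  rw [← h2.tsum_eq]
  have hV : 0 < maxV α₀ α := (α j + α₀).den_pos.trans_le
    (Finset.le_sup (f := fun j => (α j + α₀).den) (mem_univ j))
  have hρ : 0 ≤ ‖(z : ℚ_[p])‖ ^ M * ((M : ℝ) * (maxU α₀ α + maxV α₀ α * (M : ℕ))) := by positivity
  refine IsUltrametricDist.norm_tsum_le_of_forall_le fun k => ?_
  rw [← sub_mul, ← Rat.cast_sub, ← map_sub]
  rcases lt_or_ge k M with hk | hk
  · rw [PowerSeries.X_pow_dvd_iff.mp (X_pow_dvd_padeQ_mul_sub ν h₀ hα hν j) k hk]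
    simpa using hρ
  · have hP : PowerSeries.coeff k (padeP α₀ α ν j : PowerSeries ℚ) = 0 := by
      rw [Polynomial.coeff_coe, padeP, PowerSeries.coeff_trunc, if_neg (by omega)]
    rw [map_sub, hP, sub_zero, PowerSeries.coeff_mul]
    push_cast
    rw [sum_mul, mul_sum]
    -- Each term of the convolution splits the denominator: `padeDenom` makes the coefficient of `Q`
    -- integral, and `phiDenom` controls the coefficient of `φ_j`.
    refine IsUltrametricDist.norm_sum_le_of_forall_le_of_nonneg hρ fun x hx => ?_
    have hx := mem_antidiagonal.mp hx
    obtain ⟨c, hc⟩ := exists_int_padeDenom_mul_coeff α₀ α ν x.1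
    have hc' : (padeDenom α₀ α ν : ℚ_[p]) * ((padeQ α₀ α ν).coeff x.1 : ℚ) = c := by
      exact_mod_cast congrArg (fun y : ℚ => (y : ℚ_[p])) hc
    rw [coeff_phiSeries,
      show (padeDenom α₀ α ν : ℚ_[p]) * phiDenom α₀ α M * (((padeQ α₀ α ν).coeff x.1 : ℚ) *
        (phiCoeff α₀ (α j) x.2 : ℚ) * (z : ℚ_[p]) ^ k) =
        ((padeDenom α₀ α ν : ℚ_[p]) * ((padeQ α₀ α ν).coeff x.1 : ℚ)) *
        (phiDenom α₀ α M * (phiCoeff α₀ (α j) x.2 : ℚ) * (z : ℚ_[p]) ^ k) by ring, hc', norm_mul,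
      norm_mul, norm_mul, norm_pow]
    refine (mul_le_of_le_one_left (by positivity) (Padic.norm_int_le_one c)).trans ?_
    refine norm_phiDenom_mul_phiCoeff_mul_pow_le h₀ hα j (norm_nonneg _) ?_ hM hk (by omega)
    have : (0 : ℝ) ≤ dTilde α₀ α * ‖(z : ℚ_[p])‖ := by positivity
    linarith

theorem inv_abs_le_norm_intCast {z : ℤ} (hz : z ≠ 0) : |(z : ℝ)|⁻¹ ≤ ‖(z : ℚ_[p])‖ := by
  have h := inv_natCast_le_norm (p := p) (Int.natAbs_ne_zero.mpr hz)
  rwa [norm_natAbs, Nat.cast_natAbs, Int.cast_abs] at h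

/-- The lower bound for a linear form obtained from one Padé approximation. -/
theorem inv_le_norm_linearForm (h₀ : 0 < α₀) (hα : ∀ j, 0 < α j)
    (hν : ∀ j : Fin m, ν j.succ ≤ ν 0) (hM : 0 < ∑ i, ν i) {a b : ℤ} (hb : b ≠ 0)
    (hb1 : ‖(b : ℚ_[p])‖ = 1) (hba : |b| ≤ |a|)
    (ha : 16 * dTilde α₀ α * ‖(a : ℚ_[p])‖ ≤ 1) (ℓ : Fin (m + 1) → ℤ)
    (hne : (ℓ 0 : ℚ) * (padeQ α₀ α ν).eval ((a : ℚ) / b) +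
      ∑ j : Fin m, (ℓ j.succ : ℚ) * (padeP α₀ α ν j).eval ((a : ℚ) / b) ≠ 0) {Z : ℝ}
    (hZ : ((padeDenom α₀ α ν * phiDenom α₀ α (∑ i, ν i) : ℕ) : ℝ) *
      ((∑ i, ν i : ℕ) * (padeBound α₀ α ν : ℚ)) *
      (|(ℓ 0 : ℝ)| * (|(a : ℝ)| ^ padeDegree ν * |(b : ℝ)| ^ ν 0) +
        ∑ j : Fin m, |(ℓ j.succ : ℝ)| * (|(a : ℝ)| ^ (∑ i, ν i - ν j.succ - 1) *
          |(b : ℝ)| ^ (ν j.succ + 1))) ≤ Z)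
    (hZ1 : Z * (‖(a : ℚ_[p])‖ ^ (∑ i, ν i) *
        ((∑ i, ν i : ℕ) * (maxU α₀ α + maxV α₀ α * (∑ i, ν i : ℕ)))) < 1) :
    Z⁻¹ ≤ ‖(ℓ 0 : ℚ_[p]) + ∑ j : Fin m, (ℓ j.succ : ℚ_[p]) *
      phi p α₀ (α j) ((a : ℚ_[p]) / (b : ℚ_[p]))‖ := by
  set M := ∑ i, ν i with hMdef
  set z : ℚ := (a : ℚ) / b with hz
  set D : ℕ := padeDenom α₀ α ν * phiDenom α₀ α M with hD
  have hDpos : 0 < D := Nat.mul_pos (padeDenom_pos _ _ _) (phiDenom_pos _ _ _)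
  have hMN : M = padeDegree ν + ν 0 := sum_eq_padeDegree_add ν
  have hzp : (z : ℚ_[p]) = (a : ℚ_[p]) / b := by rw [hz]; push_cast; rfl
  have hznorm : ‖(z : ℚ_[p])‖ = ‖(a : ℚ_[p])‖ := by rw [hzp, norm_div, hb1, div_one]
  have hb0 : (b : ℚ) ≠ 0 := by exact_mod_cast hb
  have hbpos : 0 < |(b : ℚ)| := abs_pos.mpr hb0
  have habq : |(b : ℚ)| ≤ |(a : ℚ)| := by exact_mod_cast hba
  have hz1 : 1 ≤ |z| := by rw [hz, abs_div, one_le_div hbpos]; exact habq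
  have hQint : ∀ k, ∃ c : ℤ, (D : ℚ) * (padeQ α₀ α ν).coeff k = c := fun k => by
    obtain ⟨c, hc⟩ := exists_int_padeDenom_mul_coeff α₀ α ν k
    refine ⟨phiDenom α₀ α M * c, ?_⟩
    rw [hD]; push_cast; rw [← hc]; ring
  obtain ⟨cQ, hcQ⟩ := exists_int_mul_pow_mul_eval (M := M) hQint
    ((natDegree_padeQ_le ν).trans (by omega)) a hb
  choose cP hcP using fun j => exists_int_mul_pow_mul_eval (M := M)
    (exists_int_mul_coeff_padeP ν h₀ hα j) ((natDegree_padeP_le ν j).trans (by omega)) a hb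
  rw [← hz] at hcQ
  simp only [← hz, ← hMdef, ← hD] at hcP
  set g : ℤ := ℓ 0 * cQ + ∑ j : Fin m, ℓ j.succ * cP j with hg
  have hgq : (g : ℚ) = D * b ^ M * ((ℓ 0 : ℚ) * (padeQ α₀ α ν).eval z +
      ∑ j : Fin m, (ℓ j.succ : ℚ) * (padeP α₀ α ν j).eval z) := by
    rw [hg]; push_cast
    simp only [← hcQ, ← hcP]
    rw [mul_add, mul_sum]
    congr 1
    · ring
    · exact sum_congr rfl fun j _ => by ring
  have hg0 : g ≠ 0 := by
    have : (g : ℚ) ≠ 0 := by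
      rw [hgq]
      exact mul_ne_zero (mul_ne_zero (by exact_mod_cast hDpos.ne') (pow_ne_zero _ hb0)) hne
    exact_mod_cast this
  have hBpos : 0 ≤ padeBound α₀ α ν := by unfold padeBound; positivity
  have hM1 : (1 : ℚ) ≤ M := by exact_mod_cast hM
  have hpow : ∀ i ≤ M, |(b : ℚ)| ^ M * |z| ^ i = |(a : ℚ)| ^ i * |(b : ℚ)| ^ (M - i) := by
    intro i hi
    rw [hz, abs_div, div_pow]
    nth_rw 1 [← Nat.add_sub_cancel' hi]
    rw [pow_add]
    field_simp
  have hgsize : |(g : ℚ)| ≤ D * (M * padeBound α₀ α ν) *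
      (|(ℓ 0 : ℚ)| * (|(a : ℚ)| ^ padeDegree ν * |(b : ℚ)| ^ ν 0) +
        ∑ j : Fin m, |(ℓ j.succ : ℚ)| * (|(a : ℚ)| ^ (M - ν j.succ - 1) *
          |(b : ℚ)| ^ (ν j.succ + 1))) := by
    rw [hgq, abs_mul, abs_mul, abs_pow, Nat.abs_cast, mul_assoc (D : ℚ), mul_assoc (D : ℚ)]
    refine mul_le_mul_of_nonneg_left ?_ (by positivity)
    refine (mul_le_mul_of_nonneg_left (abs_add_le _ _) (by positivity)).trans ?_
    rw [mul_add, mul_add]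
    refine add_le_add ?_ ?_
    · rw [abs_mul]
      have h1 := abs_eval_padeQ_le h₀ hα hν hz1
      calc _ ≤ |(b : ℚ)| ^ M * (|(ℓ 0 : ℚ)| * (padeBound α₀ α ν * |z| ^ padeDegree ν)) := by gcongr
        _ = padeBound α₀ α ν * |(ℓ 0 : ℚ)| * (|(b : ℚ)| ^ M * |z| ^ padeDegree ν) := by ring
        _ = 1 * padeBound α₀ α ν * (|(ℓ 0 : ℚ)| * (|(a : ℚ)| ^ padeDegree ν * |(b : ℚ)| ^ ν 0)) := by
          rw [hpow _ (by omega), show M - padeDegree ν = ν 0 by omega]; ring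
        _ ≤ _ := by gcongr
    · rw [mul_sum]
      refine (mul_le_mul_of_nonneg_left (abs_sum_le_sum_abs _ _) (by positivity)).trans ?_
      rw [mul_sum]
      refine sum_le_sum fun j _ => ?_
      rw [abs_mul]
      have h1 := abs_eval_padeP_le h₀ hα hν hz1 j
      rw [← hMdef] at h1
      have h2 : ν 0 + ν j.succ ≤ M := by
        rw [hMdef, Fin.sum_univ_succ]
        exact Nat.add_le_add_left (single_le_sum (f := fun j : Fin m => ν j.succ)
          (fun _ _ => Nat.zero_le _) (mem_univ j)) _
      have h3 := hν j
      have hb1' : (1 : ℚ) ≤ |(b : ℚ)| := by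
        exact_mod_cast Int.one_le_abs hb
      calc _ ≤ |(b : ℚ)| ^ M * (|(ℓ j.succ : ℚ)| *
            (M * padeBound α₀ α ν * |z| ^ (M - ν j.succ - 1))) := by gcongr
        _ = M * padeBound α₀ α ν * |(ℓ j.succ : ℚ)| *
            (|(b : ℚ)| ^ M * |z| ^ (M - ν j.succ - 1)) := by ring
        _ = M * padeBound α₀ α ν * |(ℓ j.succ : ℚ)| *
            (|(a : ℚ)| ^ (M - ν j.succ - 1) * |(b : ℚ)| ^ (M - (M - ν j.succ - 1))) := by
          rw [hpow _ (by omega)]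
        _ ≤ M * padeBound α₀ α ν * |(ℓ j.succ : ℚ)| *
            (|(a : ℚ)| ^ (M - ν j.succ - 1) * |(b : ℚ)| ^ (ν j.succ + 1)) := by
          gcongr
          omega
        _ = _ := by ring
  have hgZ : |(g : ℝ)| ≤ Z := by
    refine le_trans ?_ hZ
    exact_mod_cast (Rat.cast_le (K := ℝ)).mpr hgsize
  have hgpos : 0 < |(g : ℝ)| := abs_pos.mpr (by exact_mod_cast hg0)
  have hZpos : 0 < Z := hgpos.trans_le hgZ
  set ρ := ‖(a : ℚ_[p])‖ ^ M * ((M : ℝ) * (maxU α₀ α + maxV α₀ α * (M : ℕ))) with hρ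
  have hρ0 : 0 ≤ ρ := by positivity
  set Λ := (ℓ 0 : ℚ_[p]) + ∑ j : Fin m, (ℓ j.succ : ℚ_[p]) *
      phi p α₀ (α j) ((a : ℚ_[p]) / (b : ℚ_[p])) with hΛ
  -- Eliminating the `P_j` through the remainders expresses `g` as an integer multiple of `Λ` minus
  -- a `p`-adically small number.
  have hgp : (g : ℚ_[p]) = (cQ : ℚ_[p]) * Λ - (b : ℚ_[p]) ^ M * ∑ j : Fin m, (ℓ j.succ : ℚ_[p]) *
      ((D : ℚ_[p]) * (((padeQ α₀ α ν).eval z : ℚ) * phi p α₀ (α j) z -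
        ((padeP α₀ α ν j).eval z : ℚ))) := by
    have h1 : (cQ : ℚ_[p]) = D * b ^ M * ((padeQ α₀ α ν).eval z : ℚ) := by
      exact_mod_cast (congrArg (fun y : ℚ => (y : ℚ_[p])) hcQ).symm
    have h2 : (g : ℚ_[p]) = D * b ^ M * ((ℓ 0 : ℚ_[p]) * ((padeQ α₀ α ν).eval z : ℚ) +
      ∑ j : Fin m, (ℓ j.succ : ℚ_[p]) * ((padeP α₀ α ν j).eval z : ℚ)) := by
      exact_mod_cast congrArg (fun y : ℚ => (y : ℚ_[p])) hgq
    rw [h1, h2, hΛ, ← hzp, mul_add, mul_add, mul_sum, mul_sum, mul_sum, add_sub_assoc,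
      ← sum_sub_distrib]
    congr 1
    · ring
    · exact sum_congr rfl fun j _ => by ring
  have hrem : ‖(b : ℚ_[p]) ^ M * ∑ j : Fin m, (ℓ j.succ : ℚ_[p]) *
      ((D : ℚ_[p]) * (((padeQ α₀ α ν).eval z : ℚ) * phi p α₀ (α j) z -
        ((padeP α₀ α ν j).eval z : ℚ)))‖ ≤ ρ := by
    rw [norm_mul, norm_pow, hb1, one_pow, one_mul]
    refine IsUltrametricDist.norm_sum_le_of_forall_le_of_nonneg hρ0 fun j _ => ?_
    rw [norm_mul]
    refine (mul_le_of_le_one_left (norm_nonneg _) (Padic.norm_int_le_one _)).trans ?_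
    have h := norm_remainder_le (p := p) h₀ hα hν hM (z := z) (by rwa [hznorm]) j
    rwa [hznorm] at h
  have hginv : Z⁻¹ ≤ ‖(g : ℚ_[p])‖ :=
    (inv_anti₀ hgpos hgZ).trans (inv_abs_le_norm_intCast hg0)
  have hρlt : ρ < Z⁻¹ := by
    rw [← one_div, lt_div_iff₀ hZpos, mul_comm]; exact hZ1
  -- Ultrametric dichotomy: since `|g|_p ≥ 1 / Z > ρ`, the remainder cannot account for `g`, so the
  -- multiple of `Λ` must.
  have hmax : ‖(g : ℚ_[p])‖ ≤ max ‖(cQ : ℚ_[p]) * Λ‖ ρ := by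
    rw [hgp, sub_eq_add_neg]
    refine (Padic.nonarchimedean _ _).trans (max_le_max le_rfl ?_)
    rwa [norm_neg]
  rcases le_max_iff.mp hmax with h | h
  · refine hginv.trans (h.trans ?_)
    rw [norm_mul]
    exact mul_le_of_le_one_left (norm_nonneg _) (Padic.norm_int_le_one _)
  · exact absurd (hginv.trans h) (not_le.mpr hρlt)

end

/-! ### Collecting all costs into `exp ((c₈ + 2) M)`. -/

section Constants

variable {m : ℕ} {α₀ : ℚ} {α : Fin m → ℚ}

theorem pochDenom_le (x : ℚ) (n : ℕ) : (pochDenom x n : ℝ) ≤ (x.den * eps x.den) ^ n := by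
  rw [pochDenom, mul_pow]
  push_cast
  exact mul_le_mul_of_nonneg_left (factorialPart_le _ _) (by positivity)

theorem one_le_den_mul_eps (x : ℚ) : 1 ≤ (x.den : ℝ) * eps x.den :=
  one_le_mul_of_one_le_of_one_le (by exact_mod_cast x.den_pos) (one_le_eps _)

theorem padeDenom_le (hm : 1 ≤ m) (ν : Fin (m + 1) → ℕ) : (padeDenom α₀ α ν : ℝ) ≤
    ((α₀.den * eps α₀.den) * (maxS α * eps (lcmS α))) ^ (∑ i, ν i) := by
  have hS : ∀ j, ((α j).den : ℝ) ≤ maxS α := fun j => by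
    exact_mod_cast Finset.le_sup (f := fun j => (α j).den) (mem_univ j)
  have he : ∀ j, eps (α j).den ≤ eps (lcmS α) := fun j =>
    eps_le_eps_of_dvd (Finset.dvd_lcm (f := fun j => (α j).den) (mem_univ j)) (lcmS_ne_zero α)
  have h1 : 1 ≤ (maxS α : ℝ) * eps (lcmS α) := by
    refine one_le_mul_of_one_le_of_one_le (le_trans ?_ (hS ⟨0, hm⟩)) (one_le_eps _)
    exact_mod_cast (α ⟨0, hm⟩).den_pos
  have h2 : (∏ j, (pochDenom (α j) (ν j.succ) : ℝ)) ≤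
      (maxS α * eps (lcmS α)) ^ padeDegree ν := by
    rw [padeDegree, ← prod_pow_eq_pow_sum]
    refine prod_le_prod (fun _ _ => by positivity) fun j _ => (pochDenom_le _ _).trans ?_
    have := eps_pos (α j).den
    exact pow_le_pow_left₀ (by positivity) (mul_le_mul (hS j) (he j) this.le (by positivity)) _
  have h3 := pochDenom_le α₀ (padeDegree ν)
  have h4 := one_le_den_mul_eps α₀
  rw [padeDenom]
  push_cast
  calc _ ≤ (α₀.den * eps α₀.den) ^ padeDegree ν * (maxS α * eps (lcmS α)) ^ padeDegree ν :=
        mul_le_mul h3 h2 (by positivity) (by positivity)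
    _ = ((α₀.den * eps α₀.den) * (maxS α * eps (lcmS α))) ^ padeDegree ν := (mul_pow _ _ _).symm
    _ ≤ _ := by
      refine pow_le_pow_right₀ (one_le_mul_of_one_le_of_one_le h4 h1) ?_
      rw [sum_eq_padeDegree_add]; omega

theorem phiDenom_le {θ c : ℝ} (h : AdmissiblePrimeBound θ c) {M : ℕ} (hM : c ≤ M)
    (hV : 1 ≤ maxV α₀ α) : (phiDenom α₀ α M : ℝ) ≤
      Real.exp (θ * (maxU α₀ α + maxV α₀ α * M)) * dTilde α₀ α ^ M * eps (lcmS α) ^ M := by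
  rw [phiDenom]
  push_cast
  have h1 : c ≤ ((maxU α₀ α + maxV α₀ α * M : ℕ) : ℝ) := by
    refine hM.trans ?_
    exact_mod_cast (Nat.le_mul_of_pos_left M hV).trans (Nat.le_add_left _ _)
  have h2 := lcmUpTo_le h h1
  push_cast at h2
  have h3 := factorialPart_le (lcmS α) M
  gcongr

/-- At a `j` with maximal `s_j`, use `s₀ s_j = d_j v_j`. This is how `d` enters `c₆` in place of `s₀
S`. -/
theorem den_mul_maxS_le (hm : 1 ≤ m) : α₀.den * maxS α ≤ lcmD α₀ α * maxV α₀ α := by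
  have : Nonempty (Fin m) := ⟨⟨0, hm⟩⟩
  obtain ⟨j, -, hj⟩ := Finset.exists_mem_eq_sup univ univ_nonempty fun j => (α j).den
  rw [maxS, hj, dPart_mul]
  exact Nat.mul_le_mul (Nat.le_of_dvd (Nat.pos_of_ne_zero (lcmD_ne_zero α₀ α))
    (Finset.dvd_lcm (f := fun j => dPart α₀ (α j)) (mem_univ j)))
    (Finset.le_sup (f := fun j => (α j + α₀).den) (mem_univ j))

theorem log_le_of_natCast {M : ℕ} (hM : 0 < M) : Real.log M ≤ 0.368 * M := by
  have hM0 : (0 : ℝ) < M := by exact_mod_cast hM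
  have h := Real.log_le_sub_one_of_pos (div_pos hM0 (Real.exp_pos 1))
  rw [Real.log_div hM0.ne' (Real.exp_pos 1).ne', Real.log_exp] at h
  -- `0.368` exceeds `1 / e`, the maximum of `log x / x`.
  have h1 : (M : ℝ) / Real.exp 1 ≤ 0.368 * M := by
    rw [div_le_iff₀ (Real.exp_pos 1)]
    nlinarith [Real.exp_one_gt_d9]
  linarith

theorem log_le_sub_one_mul {V : ℕ} (hV : 1 ≤ V) : Real.log V ≤ 0.6932 * (V - 1) := by
  have h1 : (V : ℝ) ≤ 2 ^ (V - 1) := by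
    exact_mod_cast (by have := Nat.lt_two_pow_self (n := V - 1); omega : V ≤ 2 ^ (V - 1))
  have hV0 : (0 : ℝ) < V := by exact_mod_cast hV
  have hV1 : (1 : ℝ) ≤ V := by exact_mod_cast hV
  have h2 := Real.log_le_log hV0 h1
  rw [Real.log_pow, Nat.cast_sub hV, Nat.cast_one] at h2
  nlinarith [Real.log_two_lt_d9]

theorem c8_add_two_eq (θ : ℝ) : c8 θ α₀ α + 2 =
    Real.log α₀.den + Real.log (eps α₀.den) + Real.log (eps (lcmV α₀ α)) + θ * maxV α₀ α +
      Real.log (dTilde α₀ α) + 2 * Real.log (eps (lcmS α)) + 2 * θ * α₀.den +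
      Real.log (lcmD α₀ α) + m * θ * maxV α₀ α + 5 := by
  have hs : (α₀.den : ℝ) ≠ 0 := by exact_mod_cast α₀.den_ne_zero
  have hd : (lcmD α₀ α : ℝ) ≠ 0 := by exact_mod_cast lcmD_ne_zero α₀ α
  have hdt : (dTilde α₀ α : ℝ) ≠ 0 := by exact_mod_cast (dTilde_pos α₀ α).ne'
  have he1 := (eps_pos α₀.den).ne'
  have he2 := (eps_pos (lcmV α₀ α)).ne'
  have he3 := (eps_pos (lcmS α)).ne'
  rw [c8, c3, c4, c6, c7, Real.log_mul (mul_ne_zero (pow_ne_zero _ hs) he1) he2,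
    Real.log_mul (pow_ne_zero _ hs) he1, Real.log_pow, Real.log_mul hdt he3,
    Real.log_div (mul_ne_zero hd he3) hs, Real.log_mul hd he3]
  push_cast
  ring

/-- Ensures that the lower bound for `log |a|` also forces `16 d̃ |a|_p ≤ 1`. -/
theorem log_dTilde_add_five_le {θ : ℝ} (hθ : 1 < θ) : Real.log (dTilde α₀ α) + 5 ≤ c8 θ α₀ α + 2 := by
  rw [c8_add_two_eq]
  have h1 := Real.log_natCast_nonneg α₀.den
  have h2 := Real.log_nonneg (one_le_eps α₀.den)
  have h3 := Real.log_nonneg (one_le_eps (lcmV α₀ α))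
  have h4 := Real.log_nonneg (one_le_eps (lcmS α))
  have h5 := Real.log_natCast_nonneg (lcmD α₀ α)
  have h6 : 0 ≤ θ * maxV α₀ α := by positivity
  have h7 : 0 ≤ 2 * θ * α₀.den := by positivity
  have h8 : 0 ≤ m * θ * maxV α₀ α := by positivity
  linarith

theorem one_le_maxV (hm : 1 ≤ m) : 1 ≤ maxV α₀ α :=
  (α ⟨0, hm⟩ + α₀).den_pos.trans_le
    (Finset.le_sup (f := fun j => (α j + α₀).den) (mem_univ _))

theorem one_le_maxU (hm : 1 ≤ m) (h₀ : 0 < α₀) (hα : ∀ j, 0 < α j) : 1 ≤ maxU α₀ α :=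
  (num_natAbs_pos (add_pos (hα ⟨0, hm⟩) h₀)).trans_le
    (Finset.le_sup (f := fun j => (α j + α₀).num.natAbs) (mem_univ _))

/-- The logarithm of the total cost as real arithmetic. Terms not proportional to `M` are absorbed
by one `M`, using `c₁ + c₅ ≤ M`. With it, four logarithms of size at most `0.368 M` and `2 M log 2`
stay below the `5 M` available. -/
theorem sum_logs_le {θ m M s₀ U V R S r ls₀ le₀ lS les lev ld ldt lPD lφD lM lB lm lUV : ℝ}
    (hθ : 1 < θ) (hm : 1 ≤ m) (hM : 3 ≤ M) (hs₀ : 1 ≤ s₀) (hU : 1 ≤ U) (hV : 1 ≤ V)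
    (hR : 0 ≤ R) (hS : 0 ≤ S) (hr : 0 ≤ r) (hls₀ : ls₀ = Real.log s₀) (hlev : 0 ≤ lev)
    (hM15 : θ * (m * (R + S) + U) + θ * (2 * (r - s₀) + m * U) ≤ M)
    (l1 : lPD ≤ M * (ls₀ + le₀ + (lS + les)))
    (l2 : lφD ≤ θ * (U + V * M) + M * ldt + M * les)
    (l3 : ls₀ + lS ≤ ld + Real.log V)
    (l4 : lB ≤ 0.6932 * (2 * M + r + m * (R + M)))
    (l5 : lM ≤ 0.368 * M) (l6 : lm ≤ lM)
    (l7 : lUV ≤ 0.6932 + Real.log U + Real.log V + lM)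
    (l8 : Real.log U ≤ U - 1) (l9 : Real.log V ≤ 0.6932 * (V - 1)) :
    lm + (lPD + lφD + (lM + lB) + (lM + lUV)) ≤
      (ls₀ + le₀ + lev + θ * V + ldt + 2 * les + 2 * θ * s₀ + ld + m * θ * V + 5) * M := by
  have hM0 : 0 ≤ M := by linarith
  have hlV : 0 ≤ Real.log V := Real.log_nonneg hV
  have e1 : θ * U + U + m * R + 2 * r ≤ M + 2 * θ * s₀ := by
    have a1 : 0 ≤ (θ - 1) * (m * R) := mul_nonneg (by linarith) (by positivity)
    have a2 : 0 ≤ θ * (m * S) := by positivity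
    have a3 : 0 ≤ (θ - 1) * r := mul_nonneg (by linarith) hr
    have a4 : 0 ≤ (θ - 1) * (m * U) := mul_nonneg (by linarith) (by positivity)
    have a5 : 0 ≤ (m - 1) * U := mul_nonneg (by linarith) (by linarith)
    linarith
  have e2 : 2 * θ * s₀ ≤ M * (2 * θ * s₀) :=
    le_mul_of_one_le_left (by positivity) (by linarith)
  have e3 : 0 ≤ M * (ld + Real.log V - ls₀ - lS) := mul_nonneg hM0 (by linarith)
  have e4 : 0 ≤ M * lev := mul_nonneg hM0 hlev
  -- The lone `log V` is at most `(M / 3) log V`, whence the factor `4 / 3`; the term `m θ V` of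
  -- `c₇` then pays for `log V` and for the `m log 2` of the coefficient bound.
  have e5 : M * (Real.log V + 0.6932 * m) + Real.log V ≤ M * (m * θ * V) := by
    have h1 : 0 ≤ (M - 3) * Real.log V := mul_nonneg (by linarith) hlV
    have h2 : 0 ≤ m * V * (θ - 1) := mul_nonneg (by positivity) (by linarith)
    have h3 : 0 ≤ (m - 1) * (V - 1) := mul_nonneg (by linarith) (by linarith)
    have h4 : 0 ≤ M * (m * θ * V - (4 / 3) * Real.log V - 0.6932 * m) :=
      mul_nonneg hM0 (by linarith)
    linarith
  have e6 : 0 ≤ m * R := by positivity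
  have e7 : 0 ≤ M * ls₀ := mul_nonneg hM0 (hls₀ ▸ Real.log_nonneg hs₀)
  linarith

/-- The product of all denominators and bounds is at most `exp ((c₈ + 2) M)`. -/
theorem pade_total_le (hm : 1 ≤ m) (h₀ : 0 < α₀) (hα : ∀ j, 0 < α j) {θ c : ℝ}
    (h : AdmissiblePrimeBound θ c) (ν : Fin (m + 1) → ℕ)
    (hMc : ((m : ℝ) + 1) * c ≤ (∑ i, ν i : ℕ))
    (hM15 : c1 θ α₀ α + c5 θ α₀ α ≤ (∑ i, ν i : ℕ)) :
    ((m : ℝ) + 1) * (((padeDenom α₀ α ν * phiDenom α₀ α (∑ i, ν i) : ℕ) : ℝ) *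
      ((∑ i, ν i : ℕ) * (padeBound α₀ α ν : ℚ)) *
      ((∑ i, ν i : ℕ) * (maxU α₀ α + maxV α₀ α * (∑ i, ν i : ℕ)))) ≤
      Real.exp ((c8 θ α₀ α + 2) * (∑ i, ν i : ℕ)) := by
  set M := ∑ i, ν i with hMdef
  have hθ := h.1
  have hc := h.2.1
  have hm1 : (1 : ℝ) ≤ m := by exact_mod_cast hm
  have hMm : (m : ℝ) + 1 < M := lt_of_lt_of_le (by nlinarith) hMc
  have hMcc : c ≤ M := le_trans (by nlinarith) hMc
  have hM3' : m + 2 ≤ M := by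
    have : m + 1 < M := by exact_mod_cast hMm
    omega
  have hM3 : (3 : ℝ) ≤ M := by exact_mod_cast (by omega : 3 ≤ M)
  have hMpos : 0 < M := by omega
  have hV := one_le_maxV (α₀ := α₀) (α := α) hm
  have hU := one_le_maxU hm h₀ hα
  have hV1 : (1 : ℝ) ≤ maxV α₀ α := by exact_mod_cast hV
  have hU1 : (1 : ℝ) ≤ maxU α₀ α := by exact_mod_cast hU
  have hSpos : (0 : ℝ) < maxS α := by
    exact_mod_cast (α ⟨0, hm⟩).den_pos.trans_le
      (Finset.le_sup (f := fun j => (α j).den) (mem_univ _))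
  have hs0 : (0 : ℝ) < α₀.den := by exact_mod_cast α₀.den_pos
  have hs01 : (1 : ℝ) ≤ α₀.den := by exact_mod_cast α₀.den_pos
  have hd0 : (0 : ℝ) < lcmD α₀ α := by exact_mod_cast Nat.pos_of_ne_zero (lcmD_ne_zero α₀ α)
  have hdt0 : (0 : ℝ) < dTilde α₀ α := by exact_mod_cast dTilde_pos α₀ α
  have he0 := eps_pos α₀.den
  have hes := eps_pos (lcmS α)
  have hev := Real.log_nonneg (one_le_eps (lcmV α₀ α))
  have hPD0 : (0 : ℝ) < padeDenom α₀ α ν := by exact_mod_cast padeDenom_pos α₀ α ν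
  have hφD0 : (0 : ℝ) < phiDenom α₀ α M := by exact_mod_cast phiDenom_pos α₀ α M
  have hM0 : (0 : ℝ) < M := by linarith
  have hUV0 : (0 : ℝ) < maxU α₀ α + maxV α₀ α * M := by positivity
  have l1 : Real.log (padeDenom α₀ α ν) ≤ M * (Real.log α₀.den + Real.log (eps α₀.den) +
      (Real.log (maxS α) + Real.log (eps (lcmS α)))) := by
    have := Real.log_le_log hPD0 (padeDenom_le hm ν)
    rwa [Real.log_pow, Real.log_mul (by positivity) (by positivity), Real.log_mul hs0.ne' he0.ne',
      Real.log_mul hSpos.ne' hes.ne'] at this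
  have l2 : Real.log (phiDenom α₀ α M) ≤ θ * (maxU α₀ α + maxV α₀ α * M) +
      M * Real.log (dTilde α₀ α) + M * Real.log (eps (lcmS α)) := by
    have := Real.log_le_log hφD0 (phiDenom_le h hMcc hV)
    rwa [Real.log_mul (by positivity) (by positivity), Real.log_mul (by positivity) (by positivity),
      Real.log_exp, Real.log_pow, Real.log_pow] at this
  have l3 : Real.log α₀.den + Real.log (maxS α) ≤ Real.log (lcmD α₀ α) + Real.log (maxV α₀ α) := by
    rw [← Real.log_mul hs0.ne' hSpos.ne', ← Real.log_mul hd0.ne' (by positivity)]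
    exact Real.log_le_log (by positivity) (by exact_mod_cast den_mul_maxS_le hm)
  have hlog2 := Real.log_two_lt_d9
  have hlog2' : 0 < Real.log 2 := Real.log_pos (by norm_num)
  have hR0 : (0 : ℝ) ≤ maxR α := by positivity
  have hr0 : (0 : ℝ) ≤ α₀.num.natAbs := by positivity
  have hNM : (padeDegree ν : ℝ) ≤ M := by
    exact_mod_cast (by rw [hMdef, sum_eq_padeDegree_add]; omega : padeDegree ν ≤ M)
  have hB : ((padeBound α₀ α ν : ℚ) : ℝ) =
      2 ^ (2 * padeDegree ν + α₀.num.natAbs + m * (maxR α + M)) := by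
    rw [padeBound]; push_cast; rfl
  have l4 : Real.log ((padeBound α₀ α ν : ℚ) : ℝ) ≤
      0.6932 * (2 * M + α₀.num.natAbs + m * (maxR α + M)) := by
    rw [hB, Real.log_pow]
    push_cast
    calc _ ≤ (2 * M + α₀.num.natAbs + m * (maxR α + M) : ℝ) * Real.log 2 := by gcongr
      _ ≤ (2 * M + α₀.num.natAbs + m * (maxR α + M) : ℝ) * 0.6932 := by gcongr; linarith
      _ = _ := mul_comm _ _
  have l5 := log_le_of_natCast hMpos
  have l6 : Real.log ((m : ℝ) + 1) ≤ Real.log M := Real.log_le_log (by positivity) hMm.le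
  have l7 : Real.log (maxU α₀ α + maxV α₀ α * M) ≤
      0.6932 + Real.log (maxU α₀ α) + Real.log (maxV α₀ α) + Real.log M := by
    have h1 : (maxU α₀ α + maxV α₀ α * M : ℝ) ≤ 2 * maxU α₀ α * maxV α₀ α * M := by
      nlinarith [mul_nonneg (sub_nonneg.mpr hU1) (sub_nonneg.mpr hV1),
        mul_le_mul_of_nonneg_left (by linarith : (1 : ℝ) ≤ M) (by positivity : (0 : ℝ) ≤ maxU α₀ α),
        mul_nonneg (mul_nonneg (sub_nonneg.mpr hU1) (by positivity : (0 : ℝ) ≤ maxV α₀ α)) hM0.le,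
        mul_nonneg (mul_nonneg (sub_nonneg.mpr hV1) (by positivity : (0 : ℝ) ≤ maxU α₀ α)) hM0.le]
    have h2 := Real.log_le_log hUV0 h1
    rw [Real.log_mul (by positivity) (by positivity), Real.log_mul (by positivity) (by positivity),
      Real.log_mul (by positivity) (by positivity)] at h2
    linarith
  have l8 : Real.log (maxU α₀ α) ≤ maxU α₀ α - 1 := Real.log_le_sub_one_of_pos (by linarith)
  have l9 := log_le_sub_one_mul hV
  have l10 : Real.log ((m : ℝ) + 1) + (Real.log (padeDenom α₀ α ν) + Real.log (phiDenom α₀ α M) +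
      (Real.log M + Real.log ((padeBound α₀ α ν : ℚ) : ℝ)) +
      (Real.log M + Real.log (maxU α₀ α + maxV α₀ α * M))) ≤ (c8 θ α₀ α + 2) * M := by
    have hnum : (α₀.num : ℝ) = α₀.num.natAbs := by
      have := Rat.num_pos.mpr h₀
      have h0 : (α₀.num.natAbs : ℤ) = α₀.num := by omega
      exact congrArg (fun z : ℤ => (z : ℝ)) h0.symm
    rw [c1, c5, hnum] at hM15
    rw [c8_add_two_eq]
    exact sum_logs_le hθ hm1 hM3 hs01 hU1 hV1 hR0 hSpos.le hr0 rfl hev hM15 l1 l2 l3 l4 l5 l6 l7 l8 l9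
  have hB0 : (0 : ℝ) < ((padeBound α₀ α ν : ℚ) : ℝ) := by rw [hB]; positivity
  rw [← Real.log_le_iff_le_exp (by push_cast; positivity)]
  push_cast
  rwa [Real.log_mul (by positivity) (by positivity), Real.log_mul (by positivity) (by positivity),
    Real.log_mul (by positivity) (by positivity), Real.log_mul hPD0.ne' hφD0.ne',
    Real.log_mul hM0.ne' hB0.ne', Real.log_mul hM0.ne' hUV0.ne']

end Constants

/-! ### Choice of the index from the heights. -/

/-- The choice of the index of the Padé approximations. -/
theorem exists_index {m : ℕ} (hm : 1 ≤ m) {L lb κ τ δ N₁ : ℝ} {h : Fin (m + 1) → ℝ}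
    (hh : ∀ i, 1 ≤ h i) (hh0 : ∀ i, h i ≤ h 0) (hlb : 0 ≤ lb) (hκ : 0 < κ) (hτ : 0 < τ) (hδ : 0 ≤ δ)
    (hτδ : τ > 4 * δ * (1 + ((m : ℝ) + 1) * τ))
    (hL : 2 * (1 + 1 / τ) * lb + 2 * ((m : ℝ) + 1 + 1 / τ) * κ < L)
    (hH1 : (N₁ + m + 1) * L / (1 + ((m : ℝ) + 1) * τ) ≤ ∑ i, Real.log (h i))
    (hH2 : 8 * L / τ ≤ ∑ i, Real.log (h i)) :
    ∃ ν : Fin (m + 1) → ℕ, (∀ i, 1 ≤ ν i) ∧ (∀ j : Fin m, ν j.succ + 1 ≤ ν 0) ∧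
      N₁ + 1 ≤ (∑ i, ν i : ℕ) ∧
      (∑ i, ν i : ℕ) * L ≤ (1 + ((m : ℝ) + 1) * τ) * ∑ i, Real.log (h i) ∧
      (∀ j : Fin m, Real.log (h j.succ) + κ * (∑ i, ν i : ℕ) + δ * (∑ i, ν i : ℕ) * L ≤
        (L - lb) * ν j.succ) ∧
      Real.log (h 0) + κ * (∑ i, ν i : ℕ) + δ * (∑ i, ν i : ℕ) * L ≤ (L - lb) * (ν 0 - 1) := by
  have hm1 : (1 : ℝ) ≤ m := by exact_mod_cast hm
  have hτi : 0 < 1 / τ := by positivity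
  have hLlb : 0 < L - lb := by nlinarith
  have hL0 : 0 < L := by linarith
  set T : ℝ := 1 + ((m : ℝ) + 1) * τ with hT
  have hT1 : 1 < T := by rw [hT]; nlinarith
  set H := ∑ i, Real.log (h i) with hH
  have hH0 : 0 ≤ H := sum_nonneg fun i _ => Real.log_nonneg (hh i)
  -- The largest total with `|a| ^ M ≤ H̃ ^ (1 + (m + 1) τ)`, the loss finally allowed.
  set M := ⌊T * H / L⌋₊ with hMdef
  have hMle : (M : ℝ) * L ≤ T * H := by
    rw [← le_div_iff₀ hL0]; exact Nat.floor_le (by positivity)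
  have hMgt : T * H < (M + 1 : ℝ) * L := by
    rw [← div_lt_iff₀ hL0]; exact Nat.lt_floor_add_one _
  have hM0 : (0 : ℝ) ≤ M := by positivity
  have hMN : N₁ + 1 ≤ M := by
    rw [div_le_iff₀ (by linarith)] at hH1
    have h1 : (N₁ + m + 1) * L < (M + 1) * L := by linarith
    have := lt_of_mul_lt_mul_right h1 hL0.le
    linarith
  have hM8 : 8 * T < (M + 1) * τ := by
    rw [div_le_iff₀ hτ] at hH2
    have h1 : (8 * T) * L < ((M + 1) * τ) * L := by nlinarith
    exact lt_of_mul_lt_mul_right h1 hL0.le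
  have hM1 : (1 : ℝ) ≤ M := by
    have h2 : 8 * ((m : ℝ) + 1) * τ < (M + 1) * τ := by nlinarith
    have := lt_of_mul_lt_mul_right h2 hτ.le
    linarith
  -- The real solution of the balance condition: `ν_i = x i` makes the gain `(L - lb) ν_i` pay for
  -- the height, the cost `κ M` and the defect `δ M L`.
  let x : Fin (m + 1) → ℝ := fun i => (Real.log (h i) + κ * M + δ * M * L) / (L - lb)
  have hxpos : ∀ i, 0 < x i := fun i => by
    have := Real.log_nonneg (hh i)
    exact div_pos (by positivity) hLlb
  have hx0 : ∀ i, x i ≤ x 0 := fun i => by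
    have := Real.log_le_log (zero_lt_one.trans_le (hh i)) (hh0 i)
    exact div_le_div_of_nonneg_right (by linarith) hLlb.le
  -- The balanced weights fit into `M` with `m + 1` units to spare: `m` for rounding up, and one for
  -- the possible lowering of `ν₀`.
  have hmain : ∑ i, x i + (m + 1) ≤ M := by
    have h1 : ∑ i, x i = (H + (m + 1) * (κ * M + δ * M * L)) / (L - lb) := by
      rw [← sum_div]
      congr 1
      simp only [add_assoc, sum_add_distrib, ← hH, sum_const, card_univ, Fintype.card_fin,
        nsmul_eq_mul]
      push_cast; ring
    rw [h1, div_add' _ _ _ hLlb.ne', div_le_iff₀ hLlb]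
    have hlin : 2 * (τ + 1) * lb + 2 * (((m : ℝ) + 1) * τ + 1) * κ < τ * L := by
      have h2 := mul_lt_mul_of_pos_left hL hτ
      have h3 : τ * (2 * (1 + 1 / τ) * lb + 2 * ((m : ℝ) + 1 + 1 / τ) * κ) =
        2 * (τ + 1) * lb + 2 * (((m : ℝ) + 1) * τ + 1) * κ := by field_simp
      linarith
    have k0 : (m + 1) * τ = T - 1 := by rw [hT]; ring
    have k1 : T * (lb + (m + 1) * κ) ≤ (T - 1) * L / 2 := by
      have h4 : 2 * T * (lb + (m + 1) * κ) ≤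
          (m + 1) * (2 * (τ + 1) * lb + 2 * (((m : ℝ) + 1) * τ + 1) * κ) := by
        rw [hT]; nlinarith only [mul_nonneg (by linarith : (0 : ℝ) ≤ m) hlb]
      have h5 := mul_lt_mul_of_pos_left hlin (by linarith : (0 : ℝ) < m + 1)
      rw [← mul_assoc, k0] at h5
      linarith only [h4, h5]
    have k2 : T * ((m + 1) * δ) ≤ (T - 1) / 4 := by
      have h6 := mul_lt_mul_of_pos_left hτδ (by linarith : (0 : ℝ) < m + 1)
      rw [k0] at h6
      linarith only [h6]
    have k3 := mul_le_mul_of_nonneg_left k1 hM0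
    have k4 := mul_le_mul_of_nonneg_left k2 (mul_nonneg hM0 hL0.le)
    have k5 : (m + 1) * (8 * T) * L ≤ (M + 1) * (T - 1) * L := by
      have h7 : (m + 1) * (8 * T) * L ≤ (m + 1) * ((M + 1) * τ) * L := by gcongr
      rwa [mul_left_comm ((m : ℝ) + 1) ((M : ℝ) + 1) τ, k0] at h7
    have hlbT : 0 ≤ T * ((m + 1) * lb) := by positivity
    have k8 : 0 ≤ (m - 1 : ℝ) * (T * L) := mul_nonneg (by linarith) (by positivity)
    have k9 : 0 ≤ (T - 1) * L := mul_nonneg (by linarith) hL0.le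
    -- The surplus `(T - 1) M L` is shared: half pays `lb` and `κ` (`k1`), a quarter pays `δ`
    -- (`k2`), and the last quarter pays the `m + 1` extra units (`k5`).
    have k6 : T * (H + (m + 1) * (κ * M + δ * M * L) + (m + 1) * (L - lb)) ≤
        T * (M * (L - lb)) := by
      linarith only [hMgt, k3, k4, k5, hlbT, k8, k9, hL0]
    exact le_of_mul_le_mul_left k6 (by linarith)
  let n : Fin m → ℕ := fun j => ⌈x j.succ⌉₊
  have hn1 : ∀ j, x j.succ ≤ n j := fun j => Nat.le_ceil _
  have hn2 : ∀ j, (n j : ℝ) < x j.succ + 1 := fun j => Nat.ceil_lt_add_one (hxpos _).le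
  have hnsum : ((∑ j, n j : ℕ) : ℝ) ≤ ∑ j : Fin m, x j.succ + m := by
    push_cast
    refine (sum_le_sum fun j _ => (hn2 j).le).trans ?_
    rw [sum_add_distrib]; simp
  rw [Fin.sum_univ_succ] at hmain
  have hle : ∑ j, n j ≤ M := by
    have : ((∑ j, n j : ℕ) : ℝ) ≤ M := by linarith [hxpos 0]
    exact_mod_cast this
  -- The place `0`, which has the largest height, receives all that is left over; it is then
  -- strictly larger than every other entry.
  let ν : Fin (m + 1) → ℕ := Fin.cons (M - ∑ j, n j) n
  have hν0 : ν 0 = M - ∑ j, n j := rfl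
  have hνs : ∀ j : Fin m, ν j.succ = n j := fun j => rfl
  have hν0r : x 0 + 1 ≤ (ν 0 : ℝ) := by
    rw [hν0, Nat.cast_sub hle]; linarith
  have hsum : ∑ i, ν i = M := by
    rw [Fin.sum_univ_succ, hν0]
    simp only [hνs]
    omega
  refine ⟨ν, ?_, ?_, ?_, ?_, ?_, ?_⟩
  · intro i
    induction i using Fin.cases with
    | zero =>
      have : (1 : ℝ) ≤ ν 0 := by linarith [hxpos 0]
      exact_mod_cast this
    | succ j => rw [hνs]; exact Nat.ceil_pos.mpr (hxpos _)
  · intro j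
    have h1 : ((ν j.succ : ℕ) : ℝ) < ν 0 := by
      rw [hνs]; linarith [hn2 j, hx0 j.succ]
    exact_mod_cast h1
  · rw [hsum]; exact hMN
  · rw [hsum]; exact hMle
  · intro j
    rw [hsum, hνs]
    have h1 := (div_le_iff₀ hLlb).mp (hn1 j)
    rwa [mul_comm (L - lb)]
  · rw [hsum]
    have h1 : x 0 ≤ (ν 0 : ℝ) - 1 := by linarith
    have h2 := (div_le_iff₀ hLlb).mp h1
    rwa [mul_comm (L - lb)]

/-! ### Heights and assembly of the estimate. -/

theorem pow_mul_pow_eq_exp {x y : ℝ} (hx : 0 < x) (hy : 0 < y) (e f : ℕ) :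
    x ^ e * y ^ f = Real.exp (e * Real.log x + f * Real.log y) := by
  rw [Real.exp_add, mul_comm (e : ℝ), mul_comm (f : ℝ), Real.exp_mul, Real.exp_mul,
    Real.exp_log hx, Real.exp_log hy, Real.rpow_natCast, Real.rpow_natCast]

/-- A weighted power product bounded through the defining inequality of the index. -/
theorem mul_pow_mul_pow_le {ℓ h a b x κ δ M M₀ : ℝ} {e f : ℕ} (hh : 0 < h) (hℓ : ℓ ≤ h) (ha : 0 < a)
    (hb : 0 < b) (hba : Real.log b ≤ Real.log a) (hδ : 0 ≤ δ) (hL : 0 ≤ Real.log a)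
    (hM₀ : M₀ = M + 1) (hef : (e : ℝ) + f = M) (hxf : x ≤ f)
    (hx : Real.log h + κ * M₀ + δ * M₀ * Real.log a ≤ (Real.log a - Real.log b) * x) :
    ℓ * (a ^ e * b ^ f) ≤ Real.exp ((1 - δ) * M * Real.log a - κ * M - κ) := by
  have h1 : ℓ * (a ^ e * b ^ f) ≤ h * (a ^ e * b ^ f) := by gcongr
  refine h1.trans ?_
  rw [pow_mul_pow_eq_exp ha hb]
  nth_rw 1 [← Real.exp_log hh]
  rw [← Real.exp_add, Real.exp_le_exp]
  have h2 := mul_le_mul_of_nonneg_left hxf (sub_nonneg.mpr hba)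
  have h3 : 0 ≤ δ * Real.log a := mul_nonneg hδ hL
  have h4 : (e : ℝ) = M - f := by linarith
  rw [h4]
  rw [hM₀] at hx
  linarith

theorem norm_intCast_eq_one_of_gcd {p : ℕ} [Fact p.Prime] {a b : ℤ} (hab : Int.gcd a b = 1)
    (ha : ‖(a : ℚ_[p])‖ < 1) : ‖(b : ℚ_[p])‖ = 1 := by
  have h1 : (p : ℤ) ∣ a := Padic.norm_intCast_lt_one_iff.mp ha
  refine le_antisymm (Padic.norm_int_le_one b) (not_lt.mp fun hb => ?_)
  have h2 : (p : ℤ) ∣ b := Padic.norm_intCast_lt_one_iff.mp hb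
  have h3 := Int.dvd_coe_gcd h1 h2
  rw [hab] at h3
  exact (Fact.out : p.Prime).one_lt.ne' (by exact_mod_cast Int.eq_one_of_dvd_one (by positivity) h3)

/-- The heights `h₀ = max |ℓ_i|` and `h_j = max {1, |ℓ_j|}`. -/
def height {m : ℕ} (ℓ : Fin (m + 1) → ℤ) : Fin (m + 1) → ℕ :=
  Fin.cons (univ.sup fun i => (ℓ i).natAbs) fun j => max 1 (ℓ j.succ).natAbs

theorem natAbs_le_height {m : ℕ} (ℓ : Fin (m + 1) → ℤ) (i : Fin (m + 1)) :
    (ℓ i).natAbs ≤ height ℓ i := by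
  induction i using Fin.cases with
  | zero => exact Finset.le_sup (f := fun i => (ℓ i).natAbs) (mem_univ 0)
  | succ j => exact le_max_right _ _

theorem one_le_height_zero {m : ℕ} {ℓ : Fin (m + 1) → ℤ} (hℓ : ℓ ≠ 0) : 1 ≤ height ℓ 0 := by
  obtain ⟨i, hi⟩ := Function.ne_iff.mp hℓ
  have h1 : 1 ≤ (ℓ i).natAbs := Nat.one_le_iff_ne_zero.mpr (Int.natAbs_ne_zero.mpr hi)
  exact h1.trans (Finset.le_sup (f := fun i => (ℓ i).natAbs) (mem_univ i))

theorem one_le_height {m : ℕ} {ℓ : Fin (m + 1) → ℤ} (hℓ : ℓ ≠ 0) (i : Fin (m + 1)) :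
    1 ≤ height ℓ i := by
  induction i using Fin.cases with
  | zero => exact one_le_height_zero hℓ
  | succ j => exact le_max_left _ _

theorem height_le_height_zero {m : ℕ} {ℓ : Fin (m + 1) → ℤ} (hℓ : ℓ ≠ 0) (i : Fin (m + 1)) :
    height ℓ i ≤ height ℓ 0 := by
  induction i using Fin.cases with
  | zero => exact le_rfl
  | succ j =>
    exact max_le (one_le_height_zero hℓ) (Finset.le_sup (f := fun i => (ℓ i).natAbs) (mem_univ _))

theorem prod_height {m : ℕ} (ℓ : Fin (m + 1) → ℤ) : ∏ i, height ℓ i = HTilde ℓ := by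
  rw [Fin.prod_univ_succ]; rfl

theorem rpow_lt_norm_linearForm (p : ℕ) [Fact p.Prime] (m : ℕ) (hm : 1 ≤ m)
    (α₀ : ℚ) (α : Fin m → ℚ) (hα₀ : 0 < α₀) (hα : ∀ j, 0 < α j)
    (hdiff : ∀ i j : Fin m, i ≠ j → ∀ k : ℤ, α i - α j ≠ k)
    (θ c : ℝ) (hθc : AdmissiblePrimeBound θ c)
    (τ δ : ℝ) (hτ : 0 < τ) (hδ : 0 ≤ δ) (hτδ : τ > 4 * δ * (1 + ((m : ℝ) + 1) * τ))
    (a b : ℤ) (ha0 : a ≠ 0) (hb : b ≠ 0) (hb1 : ‖(b : ℚ_[p])‖ = 1)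
    (hap : ‖(a : ℚ_[p])‖ ≤ |(a : ℝ)| ^ (-1 + δ))
    (ha16 : 16 * dTilde α₀ α * ‖(a : ℚ_[p])‖ ≤ 1)
    (hL : 2 * (1 + 1 / τ) * Real.log |(b : ℝ)| +
      2 * ((m : ℝ) + 1 + 1 / τ) * (c8 θ α₀ α + 2) < Real.log |(a : ℝ)|)
    (hκ : 0 < c8 θ α₀ α + 2)
    (ℓ : Fin (m + 1) → ℤ) (hℓ : ℓ ≠ 0) (hH : H0 p θ c α₀ α a τ ≤ (HTilde ℓ : ℝ)) :
    ‖(ℓ 0 : ℚ_[p]) + ∑ j : Fin m, (ℓ j.succ : ℚ_[p]) *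
      phi p α₀ (α j) ((a : ℚ_[p]) / (b : ℚ_[p]))‖ >
        (HTilde ℓ : ℝ) ^ (-1 - ((m : ℝ) + 1) * τ) := by
  set κ := c8 θ α₀ α + 2 with hκdef
  have haabs : (1 : ℝ) ≤ |(a : ℝ)| := by exact_mod_cast Int.one_le_abs ha0
  have hbabs : (1 : ℝ) ≤ |(b : ℝ)| := by exact_mod_cast Int.one_le_abs hb
  set L := Real.log |(a : ℝ)| with hLdef
  set lb := Real.log |(b : ℝ)| with hlbdef
  have hlb0 : 0 ≤ lb := Real.log_nonneg hbabs
  have hτi : 0 < 1 / τ := by positivity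
  have hm0 : (0 : ℝ) ≤ m := by positivity
  have hlbL : lb < L := by
    have h1 : 0 ≤ (2 * ((m : ℝ) + 1 + 1 / τ)) * κ := by positivity
    have h2 : 0 ≤ (1 / τ) * lb := by positivity
    linarith
  have hL0 : 0 < L := by linarith
  have hba : |b| ≤ |a| := by
    have h1 : |(b : ℝ)| ≤ |(a : ℝ)| :=
      (Real.log_le_log_iff (by linarith) (by linarith)).mp hlbL.le
    exact_mod_cast h1
  have hh1 : ∀ i, (1 : ℝ) ≤ height ℓ i := fun i => by exact_mod_cast one_le_height hℓ i
  have hHpos : (0 : ℝ) < HTilde ℓ := by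
    rw [← prod_height]; push_cast
    exact prod_pos fun i _ => by linarith [hh1 i]
  have hlogH : Real.log (HTilde ℓ) = ∑ i, Real.log (height ℓ i) := by
    rw [← prod_height]; push_cast
    exact Real.log_prod fun i _ => by linarith [hh1 i]
  have hH' := (Real.le_log_iff_exp_le hHpos).mpr hH
  rw [hlogH] at hH'
  obtain ⟨ν, hν1, hν0, hN, hML, hνs, hνz⟩ := exists_index (N₁ := N1 p θ c α₀ α a)
    (h := fun i => (height ℓ i : ℝ)) hm hh1
    (fun i => by exact_mod_cast height_le_height_zero hℓ i) hlb0 hκ hτ hδ hτδ hL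
    ((le_max_left _ _).trans hH') ((le_max_right _ _).trans hH')
  obtain ⟨i, hi⟩ := exists_padeVec_form_ne_zero hα₀ hα hdiff hν1 hν0
    (z := (a : ℚ) / b) (div_ne_zero (by exact_mod_cast ha0) (by exact_mod_cast hb)) hℓ
  have hM₀ := sum_lowerIndex_add_one hν1 i
  have hle := lowerIndex_succ_le hν0 i
  have hlow := lowerIndex_add_ite hν1 i
  set ν' := lowerIndex ν i with hν'
  have hM₀r : ((∑ k, ν k : ℕ) : ℝ) = (∑ k, ν' k : ℕ) + 1 := by exact_mod_cast hM₀.symm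
  set M₀ := ∑ k, ν k
  have hMN := sum_eq_padeDegree_add ν'
  have hsingle : ∀ j : Fin m, ν' 0 + ν' j.succ ≤ ∑ k, ν' k := fun j => by
    rw [Fin.sum_univ_succ]
    exact Nat.add_le_add_left (single_le_sum (f := fun j : Fin m => ν' j.succ)
      (fun _ _ => Nat.zero_le _) (mem_univ j)) _
  have htotal := pade_total_le hm hα₀ hα hθc ν'
    (by have := le_max_left (((m : ℝ) + 1) * c) (max (c1 θ α₀ α + c5 θ α₀ α)
          (Real.log (2 * dTilde α₀ α) + 4 * deltaDvd p (lcmS α) * Real.log |(a : ℝ)|))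
        -- The lowered index has sum one less than `ν`, which is why the index was chosen with sum
        -- at least `N1 + 1`.
        rw [N1] at hN; linarith)
    (by have := (le_max_left (c1 θ α₀ α + c5 θ α₀ α) (Real.log (2 * dTilde α₀ α) +
          4 * deltaDvd p (lcmS α) * Real.log |(a : ℝ)|)).trans (le_max_right (((m : ℝ) + 1) * c) _)
        rw [N1] at hN; linarith)
  set M := ∑ k, ν' k with hMdef
  have hMpos : 0 < M := by
    have h1 := hν0 ⟨0, hm⟩
    have h2 := hν1 (Fin.succ ⟨0, hm⟩)
    have h3 : ν 0 + ν (Fin.succ ⟨0, hm⟩) ≤ M₀ := by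
      simp only [M₀]
      rw [Fin.sum_univ_succ]
      exact Nat.add_le_add_left (single_le_sum (f := fun j : Fin m => ν j.succ)
        (fun _ _ => Nat.zero_le _) (mem_univ _)) _
    omega
  have hM1 : (1 : ℝ) ≤ M := by exact_mod_cast hMpos
  set E := (M : ℝ) * (maxU α₀ α + maxV α₀ α * (M : ℕ)) with hE
  have hV1 : (1 : ℝ) ≤ maxV α₀ α := by exact_mod_cast one_le_maxV (α₀ := α₀) (α := α) hm
  have hE1 : 1 ≤ E := by
    have hU : (0 : ℝ) ≤ maxU α₀ α := by positivity
    exact one_le_mul_of_one_le_of_one_le hM1 (by nlinarith)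
  set G := Real.exp ((1 - δ) * M * L - κ * M - κ) with hG
  have hb0 : (0 : ℝ) < |(b : ℝ)| := by linarith
  have ha0' : (0 : ℝ) < |(a : ℝ)| := by linarith
  have hℓh : ∀ k, |(ℓ k : ℝ)| ≤ height ℓ k := fun k => by
    rw [← Int.cast_abs, ← Nat.cast_natAbs]
    exact_mod_cast natAbs_le_height ℓ k
  have t0 : |(ℓ 0 : ℝ)| * (|(a : ℝ)| ^ padeDegree ν' * |(b : ℝ)| ^ ν' 0) ≤ G := by
    -- The exponent of `b` is `ν' 0`, which may be `ν 0 - 1`; hence the stronger condition imposed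
    -- at place `0`. For the numerators the exponent `ν' j.succ + 1` is always at least `ν j.succ`.
    refine mul_pow_mul_pow_le (by linarith [hh1 0]) (hℓh 0) ha0' hb0 hlbL.le hδ hL0.le hM₀r
      (by exact_mod_cast hMN.symm) (x := (ν 0 : ℝ) - 1) ?_ hνz
    have h1 := hlow 0
    have h2 : ν 0 ≤ ν' 0 + 1 := by split_ifs at h1 <;> omega
    have h3 : (ν 0 : ℝ) ≤ ν' 0 + 1 := by exact_mod_cast h2
    linarith
  have ts : ∀ j : Fin m, |(ℓ j.succ : ℝ)| * (|(a : ℝ)| ^ (M - ν' j.succ - 1) *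
      |(b : ℝ)| ^ (ν' j.succ + 1)) ≤ G := fun j => by
    have h4 := hsingle j
    have h1 := hlow j.succ
    have h6 := hlow 0
    have h7 := hν0 j
    have h8 := hν1 j.succ
    refine mul_pow_mul_pow_le (by linarith [hh1 j.succ]) (hℓh j.succ) ha0' hb0 hlbL.le hδ hL0.le
      hM₀r ?_ (x := (ν j.succ : ℝ)) ?_ (hνs j)
    · have h9 : M - ν' j.succ - 1 + (ν' j.succ + 1) = M := by
        split_ifs at h6 <;> omega
      exact_mod_cast h9
    · have h2 : ν j.succ ≤ ν' j.succ + 1 := by split_ifs at h1 <;> omega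
      exact_mod_cast h2
  set A := ((padeDenom α₀ α ν' * phiDenom α₀ α M : ℕ) : ℝ) *
      ((M : ℕ) * ((padeBound α₀ α ν' : ℚ) : ℝ)) with hA
  have hA0 : 0 ≤ A := by
    rw [hA, padeBound]; push_cast; positivity
  -- Dividing by `E` makes the polynomial factor of the remainder cancel in `hZ1`, while `htotal`
  -- contains that factor already. The spare `exp (-κ)`, from `κ M₀ = κ M + κ`, makes `hZ1` strict.
  set Z := Real.exp ((1 - δ) * M * L - κ) / E with hZdef
  have hE0 : 0 < E := by linarith
  have hZ : A * (|(ℓ 0 : ℝ)| * (|(a : ℝ)| ^ padeDegree ν' * |(b : ℝ)| ^ ν' 0) +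
        ∑ j : Fin m, |(ℓ j.succ : ℝ)| * (|(a : ℝ)| ^ (M - ν' j.succ - 1) *
          |(b : ℝ)| ^ (ν' j.succ + 1))) ≤ Z := by
    rw [hZdef, le_div_iff₀ hE0]
    have h1 : ∑ j : Fin m, |(ℓ j.succ : ℝ)| * (|(a : ℝ)| ^ (M - ν' j.succ - 1) *
          |(b : ℝ)| ^ (ν' j.succ + 1)) ≤ m * G := by
      refine (sum_le_card_nsmul _ _ _ fun j _ => ts j).trans_eq ?_
      simp
    calc _ ≤ A * (G + m * G) * E := by gcongr
      _ = ((m : ℝ) + 1) * (A * E) * G := by ring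
      _ ≤ Real.exp (κ * M) * G := by gcongr
      _ = _ := by rw [hG, ← Real.exp_add]; congr 1; ring
  have hapM : ‖(a : ℚ_[p])‖ ^ M ≤ Real.exp (-((1 - δ) * M * L)) := by
    refine (pow_le_pow_left₀ (norm_nonneg _) hap M).trans_eq ?_
    rw [Real.rpow_def_of_pos ha0', ← Real.exp_nat_mul]
    congr 1
    rw [← hLdef]; ring
  have hZ1 : Z * (‖(a : ℚ_[p])‖ ^ M * E) < 1 := by
    calc Z * (‖(a : ℚ_[p])‖ ^ M * E) = Real.exp ((1 - δ) * M * L - κ) * ‖(a : ℚ_[p])‖ ^ M := by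
          rw [hZdef]; field_simp
      _ ≤ Real.exp ((1 - δ) * M * L - κ) * Real.exp (-((1 - δ) * M * L)) := by gcongr
      _ = Real.exp (-κ) := by rw [← Real.exp_add]; congr 1; ring
      _ < 1 := (Real.exp_lt_exp.mpr (by linarith : -κ < 0)).trans_eq Real.exp_zero
  have hfinal := inv_le_norm_linearForm hα₀ hα hle hMpos hb hb1 hba ha16 ℓ hi hZ hZ1
  refine lt_of_lt_of_le ?_ hfinal
  have hZpos : 0 < Z := div_pos (Real.exp_pos _) hE0
  rw [lt_inv_comm₀ (Real.rpow_pos_of_pos hHpos _) hZpos, ← Real.rpow_neg hHpos.le]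
  calc Z ≤ Real.exp ((1 - δ) * M * L - κ) := div_le_self (Real.exp_pos _).le hE1
    _ < Real.exp (M₀ * L) := by
      refine Real.exp_lt_exp.mpr ?_
      rw [hM₀r]
      have h1 : 0 ≤ δ * M * L := by positivity
      linarith
    _ ≤ _ := by
      rw [Real.rpow_def_of_pos hHpos, Real.exp_le_exp, hlogH]
      linarith

end PadicLinForm

theorem theorem5 (p : ℕ) [Fact p.Prime] (m : ℕ) (hm : 1 ≤ m)
    (α₀ : ℚ) (α : Fin m → ℚ) (hα₀ : 0 < α₀) (hα : ∀ j, 0 < α j)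
    (hdiff : ∀ i j : Fin m, i < j → ∀ k : ℤ, α i - α j ≠ k)
    (θ c : ℝ) (hθc : PadicLinForm.AdmissiblePrimeBound θ c)
    (τ δ : ℝ) (hτ : 0 < τ) (hδ : 0 ≤ δ) (hτδ : τ > 4 * δ * (1 + ((m : ℝ) + 1) * τ))
    (a b : ℤ) (hb : b ≠ 0) (hab : Int.gcd a b = 1)
    (hap : ‖(a : ℚ_[p])‖ ≤
      min ((2 : ℝ) ^ (-(PadicLinForm.deltaTwo p (PadicLinForm.lcmS α) : ℤ)) *
          ‖(PadicLinForm.lcmS α : ℚ_[p])‖)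
        (|(a : ℝ)| ^ (-1 + δ)))
    (ha : |(a : ℝ)| > |(b : ℝ)| ^ (2 * (1 + 1 / τ)) *
      Real.exp (2 * (PadicLinForm.c2 θ α * (1 + 1 / τ) +
        (PadicLinForm.c8 θ α₀ α + 2) * ((m : ℝ) + 1 + 1 / τ)))) :
    (∀ j : Fin m, Summable (PadicLinForm.phiTerm p α₀ (α j) ((a : ℚ_[p]) / (b : ℚ_[p])))) ∧
    ∀ ℓ : Fin (m + 1) → ℤ, ℓ ≠ 0 →
      PadicLinForm.H0 p θ c α₀ α a τ ≤ (PadicLinForm.HTilde ℓ : ℝ) →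
      ‖(ℓ 0 : ℚ_[p]) + ∑ j : Fin m, (ℓ j.succ : ℚ_[p]) *
          PadicLinForm.phi p α₀ (α j) ((a : ℚ_[p]) / (b : ℚ_[p]))‖ >
        (PadicLinForm.HTilde ℓ : ℝ) ^ (-1 - ((m : ℝ) + 1) * τ) := by
  have hθ := hθc.1
  have hm1 : (1 : ℝ) ≤ m := by exact_mod_cast hm
  have hτi : 0 < 1 / τ := by positivity
  have hb0 : (0 : ℝ) < |(b : ℝ)| := abs_pos.mpr (by exact_mod_cast hb)
  have hκd := PadicLinForm.log_dTilde_add_five_le (α₀ := α₀) (α := α) hθ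
  have hld : 0 ≤ Real.log (PadicLinForm.dTilde α₀ α) := Real.log_natCast_nonneg _
  have hκ : 0 < PadicLinForm.c8 θ α₀ α + 2 := by linarith
  have ha' : (0 : ℝ) < |(a : ℝ)| :=
    lt_trans (mul_pos (Real.rpow_pos_of_pos hb0 _) (Real.exp_pos _)) ha
  have ha0 : a ≠ 0 := by
    have := abs_pos.mp ha'
    exact_mod_cast this
  have hlb : 0 ≤ Real.log |(b : ℝ)| := Real.log_nonneg (by exact_mod_cast Int.one_le_abs hb)
  have hL : 2 * (1 + 1 / τ) * Real.log |(b : ℝ)| +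
      2 * ((m : ℝ) + 1 + 1 / τ) * (PadicLinForm.c8 θ α₀ α + 2) < Real.log |(a : ℝ)| := by
    have h1 := Real.log_lt_log (mul_pos (Real.rpow_pos_of_pos hb0 _) (Real.exp_pos _)) ha
    rw [Real.log_mul (Real.rpow_pos_of_pos hb0 _).ne' (Real.exp_pos _).ne', Real.log_exp,
      Real.log_rpow hb0] at h1
    have h2 : 0 ≤ PadicLinForm.c2 θ α * (1 + 1 / τ) := by
      unfold PadicLinForm.c2; positivity
    linarith
  -- As `m + 1 ≥ 2`, the condition on `τ` gives `τ > 8 δ τ`.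
  have hδ8 : 8 * δ ≤ 1 := by
    have h1 : 4 * δ * (2 * τ) ≤ 4 * δ * (1 + ((m : ℝ) + 1) * τ) := by gcongr; nlinarith
    have h2 : (8 * δ) * τ < 1 * τ := by linarith
    exact (lt_of_mul_lt_mul_right h2 hτ.le).le
  have hL4 : 4 * (PadicLinForm.c8 θ α₀ α + 2) ≤ Real.log |(a : ℝ)| := by
    have h1 : 0 ≤ 2 * (1 + 1 / τ) * Real.log |(b : ℝ)| := by positivity
    have h2 : 0 ≤ (m - 1 + 1 / τ) * (PadicLinForm.c8 θ α₀ α + 2) :=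
      mul_nonneg (by linarith) hκ.le
    linarith
  have hap2 := hap.trans (min_le_right _ _)
  -- Since `16 d̃ ≤ exp (c₈ + 2)`, `4 (c₈ + 2) ≤ log |a|` and `δ ≤ 1 / 8`, the bound `|a| ^ (-1 +
  -- δ)` on `|a|_p` more than compensates `16 d̃`.
  have ha16 : 16 * PadicLinForm.dTilde α₀ α * ‖(a : ℚ_[p])‖ ≤ 1 := by
    have hd : (0 : ℝ) < PadicLinForm.dTilde α₀ α := by
      exact_mod_cast PadicLinForm.dTilde_pos α₀ α
    have h16 : (16 : ℝ) ≤ Real.exp 5 := by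
      have := Real.add_one_le_exp (1 : ℝ)
      have h3 : (2 : ℝ) ^ 5 ≤ Real.exp 1 ^ 5 := by gcongr; linarith
      rw [← Real.exp_nat_mul] at h3
      norm_num at h3
      linarith
    calc _ ≤ Real.exp 5 * Real.exp (Real.log (PadicLinForm.dTilde α₀ α)) *
          Real.exp (Real.log |(a : ℝ)| * (-1 + δ)) := by
          rw [Real.exp_log hd, ← Real.rpow_def_of_pos ha']
          gcongr
      _ = Real.exp (5 + Real.log (PadicLinForm.dTilde α₀ α) + Real.log |(a : ℝ)| * (-1 + δ)) := by
        rw [Real.exp_add, Real.exp_add]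
      _ ≤ 1 := by
        rw [Real.exp_le_one_iff]
        nlinarith
  -- Hence `p ∣ a`, and coprimality makes `b` a `p`-adic unit, so `|β|_p = |a|_p`.
  have hnorm : ‖(a : ℚ_[p])‖ < 1 := by
    have hd : (1 : ℝ) ≤ PadicLinForm.dTilde α₀ α := by
      exact_mod_cast PadicLinForm.dTilde_pos α₀ α
    nlinarith [norm_nonneg (a : ℚ_[p])]
  have hb1 := PadicLinForm.norm_intCast_eq_one_of_gcd hab hnorm
  refine ⟨fun j => PadicLinForm.summable_phiTerm hα₀ hα j ?_, fun ℓ hℓ hH => ?_⟩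
  · rwa [norm_div, hb1, div_one]
  · refine PadicLinForm.rpow_lt_norm_linearForm p m hm α₀ α hα₀ hα (fun i j hij k => ?_) θ c hθc τ δ
      hτ hδ hτδ a b ha0 hb hb1 hap2 ha16 hL hκ ℓ hℓ hH
    rcases lt_or_gt_of_ne hij with h | h
    · exact hdiff i j h k
    · intro hc
      refine hdiff j i h (-k) ?_
      push_cast
      linarith
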